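/- Let $\rho$ be a quantum state (a positive semidefinite $d\times d$ complex matrix with $\operatorname{Tr}\rho=1$) and let $\sigma$ be a positive semidefinite $d\times d$ complex matrix. The measured relative entropy is $$D^M(\rho\|\sigma):=\sup_{\mathcal X,(\Lambda_x)_{x\in\mathcal X}}\ \sum_{x\in\mathcal X}\operatorname{Tr}[\Lambda_x\rho]\,\ln\frac{\operatorname{Tr}[\Lambda_x\rho]}{\operatorname{Tr}[\Lambda_x\sigma]}\in(-\infty,+\infty],$$ where the supremum is over all finite alphabets $\mathcal X$ and all POVMs ($\Lambda_x\ge 0$, $\sum_x\Lambda_x=I$), with the conventions $0\ln(0/q)=0$, and the sum being $+\infty$ if $\operatorname{Tr}[\Lambda_x\rho]\neq 0=\operatorname{Tr}[\Lambda_x\sigma]$ for some $x$. For positive definite $X,Y$ let $P_{\ln}(X,Y):=X^{1/2}\ln\!\left(X^{-1/2}YX^{-1/2}\right)X^{1/2}$. Then $$D^M(\rho\|\sigma)=\sup_{\omega>0,\ \theta=\theta^\dagger}\left\{\operatorname{Tr}[\theta\rho]-\operatorname{Tr}[\omega\sigma]+1\ :\ \theta\le P_{\ln}(I,\omega)\right\}$$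 (as elements of $(-\infty,+\infty]$). Furthermore, suppose that $\operatorname{supp}(\rho)\subseteq\operatorname{supp}(\sigma)$. For positive integers $m,k$, let $t_1,\dots,t_m$ and $w_1,\dots,w_m$ be the nodes and weights of the $m$-point Gauss--Legendre quadrature on $[0,1]$, and let $$D^M_{m,k}(\rho\|\sigma):=\sup\left\{\operatorname{Tr}[\theta\rho]-\operatorname{Tr}[\omega\sigma]+1\right\},$$ where the supremum is over $d\times d$ matrices $\omega>0$ and Hermitian $\theta,T_1,\dots,T_m,Z_0,\dots,Z_k$ subject to $$Z_0=\omega,\qquad \sum_{j=1}^m w_jT_j=2^{-k}\theta,$$ $$\begin{bmatrix}Z_i&Z_{i+1}\\Z_{i+1}&I\end{bmatrix}\ge 0\quad(0\le i\le k-1),\qquad \begin{bmatrix}Z_k-I-T_j&-\sqrt{t_j}\,T_j\\-\sqrt{t_j}\,T_j&I-t_jT_j\end{bmatrix}\ge 0\quad(1\le j\le m).$$ This is a semidefinite program with $m+k$ linear matrix inequalities, each of size $2d\times 2d$. Then for every $\varepsilon>0$ there exist positive integers $m=m(\varepsilon)$ and $k=k(\varepsilon)$ such that $D^M(\rho\|\sigma)$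 and $D^M_{m,k}(\rho\|\sigma)$ are finite and $$\left|D^M(\rho\|\sigma)-D^M_{m,k}(\rho\|\sigma)\right|\le\varepsilon,$$ and these can be chosen such that $m(\varepsilon)+k(\varepsilon)=O\!\left(\sqrt{\ln(1/\varepsilon)}\right)$ as $\varepsilon\to0^+$, where the implicit constant may depend on $\rho$ and $\sigma$. In particular, the program has $O(\sqrt{\ln(1/\varepsilon)})$ linear matrix inequalities. -/

import Mathlib

open Filter Topology Asymptotics
open scoped ComplexOrder

noncomputable section

namespace MeasuredRelEnt

/-! ### States, supports, measurements -/

/-- A quantum state (density operator): positive semidefinite with unit trace. -/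
def IsState {n : Type*} [Fintype n] (ρ : Matrix n n ℂ) : Prop :=
  ρ.PosSemidef ∧ ρ.trace = 1

/-- The support of a Hermitian matrix, i.e. its range (the orthogonal complement of its kernel). -/
def support {n : Type*} [Fintype n] (A : Matrix n n ℂ) : Submodule ℂ (n → ℂ) :=
  LinearMap.range A.mulVecLin

/-- `Tr[A B]` as a real number (the trace is real when `A` and `B` are Hermitian). -/
def trMul {n : Type*} [Fintype n] (A B : Matrix n n ℂ) : ℝ :=
  (A * B).trace.re

/-- A positive operator-valued measure with outcomes in the finite alphabet `X`. -/
structure POVM (n : Type*) [Fintype n] [DecidableEq n] (X : Type*) [Fintype X] where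
  /-- the measurement operators -/
  op : X → Matrix n n ℂ
  posSemidef : ∀ x, (op x).PosSemidef
  sum_eq_one : ∑ x, op x = 1

open Classical in
/-- The relative entropy `∑ p ln (p / q)`, with `0 ln (0 / q) = 0`, and `+∞` if the support of `p`
is not contained in the support of `q`. -/
def relEnt {X : Type*} [Fintype X] (p q : X → ℝ) : EReal :=
  if Function.support p ⊆ Function.support q then
    ((∑ x, p x * Real.log (p x / q x) : ℝ) : EReal)
  else ⊤

/-- The measured relative entropy: the supremum over all finite alphabets (`Fin N` up to
relabelling) and all POVMs of the relative entropy of the outcome distributions. -/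
def measuredRelEnt {n : Type*} [Fintype n] [DecidableEq n] (ρ σ : Matrix n n ℂ) : EReal :=
  ⨆ (N : ℕ) (Λ : POVM n (Fin N)),
    relEnt (fun x => trMul (Λ.op x) ρ) (fun x => trMul (Λ.op x) σ)

/-! ### The operator connection of the logarithm -/

/-- `P_f(X, Y) = X^{1/2} f(X^{-1/2} Y X^{-1/2}) X^{1/2}` for positive definite `X`, `Y`, through
the functional calculus of Hermitian matrices. -/
def connection {n : Type*} [Fintype n] [DecidableEq n] (f : ℝ → ℝ) (X Y : Matrix n n ℂ) :
    Matrix n n ℂ :=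
  cfc Real.sqrt X * cfc f ((cfc Real.sqrt X)⁻¹ * Y * (cfc Real.sqrt X)⁻¹) * cfc Real.sqrt X

/-! ### Gauss–Legendre quadrature on `[0, 1]` -/

/-- The nodes of the `m`-point Gauss–Legendre quadrature on `[0, 1]`: the `m` roots of the `m`-th
Legendre polynomial shifted to `[0, 1]`, in increasing order. These roots are real and simple, so
the sorted list has length `m` and the default value of `getD` does not occur. -/
def gaussNode (m : ℕ) (j : Fin m) : ℝ :=
  (((Polynomial.shiftedLegendre m).map (Int.castRingHom ℝ)).roots.sort (· ≤ ·)).getD j 0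

/-- The weights of the `m`-point Gauss–Legendre quadrature on `[0, 1]`: the integrals of the
Lagrange basis polynomials of the nodes. -/
def gaussWeight (m : ℕ) (j : Fin m) : ℝ :=
  ∫ t in (0 : ℝ)..1, (Lagrange.basis Finset.univ (gaussNode m) j).eval t

/-! ### Semidefinite programs -/

/-- A function that is affine over `ℝ`, bundled as an affine map. -/
def affineOf {V W : Type*} [AddCommGroup V] [Module ℝ V] [AddCommGroup W] [Module ℝ W]
    (f : V → W) (hadd : ∀ x y, f (x + y) - f 0 = (f x - f 0) + (f y - f 0))
    (hsmul : ∀ (c : ℝ) x, f (c • x) - f 0 = c • (f x - f 0)) : V →ᵃ[ℝ] W where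
  toFun := f
  linear :=
    { toFun := fun x => f x - f 0
      map_add' := hadd
      map_smul' := hsmul }
  map_vadd' := by
    intro p v
    have h := hadd v p
    simp only [vadd_eq_add, LinearMap.coe_mk, AddHom.coe_mk]
    rw [sub_eq_iff_eq_add.mp h]
    abel

/-- A semidefinite program with variables in the real vector space `V`: an affine objective
function, affine equality constraints with values in `E`, a positive definite variable of size
`n × n`, and a family, indexed by `ι`, of linear matrix inequalities of size `p × p`. -/
structure SemidefiniteProgram (V E n ι p : Type*) [AddCommGroup V] [Module ℝ V]
    [AddCommGroup E] [Module ℝ E] where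
  /-- the objective, to be maximized -/
  objective : V →ᵃ[ℝ] ℝ
  /-- the matrix required to be positive definite -/
  pos : V →ᵃ[ℝ] Matrix n n ℂ
  /-- the quantity required to vanish -/
  eqn : V →ᵃ[ℝ] E
  /-- the matrices required to be positive semidefinite -/
  lmi : ι → V →ᵃ[ℝ] Matrix p p ℂ

namespace SemidefiniteProgram

variable {V E n ι p : Type*} [AddCommGroup V] [Module ℝ V] [AddCommGroup E] [Module ℝ E]

/-- The constraints of the program. -/
def Feasible (P : SemidefiniteProgram V E n ι p) (x : V) : Prop :=
  (P.pos x).PosDef ∧ P.eqn x = 0 ∧ ∀ i, (P.lmi i x).PosSemidef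

/-- The optimal value of the program. -/
def value (P : SemidefiniteProgram V E n ι p) : EReal :=
  ⨆ (x : V) (_ : P.Feasible x), ((P.objective x : ℝ) : EReal)

end SemidefiniteProgram

/-- The real vector space of Hermitian `n × n` matrices. -/
abbrev Herm (n : Type*) := selfAdjoint (Matrix n n ℂ)

/-- The variables `(ω, θ, (T₁, …, T_m), (Z₀, …, Z_k))` of the program below, all Hermitian. -/
abbrev Vars (n : Type*) (m k : ℕ) :=
  Herm n × Herm n × (Fin m → Herm n) × (Fin (k + 1) → Herm n)

namespace Vars

variable {n : Type*} {m k : ℕ}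

/-- The variable `ω`. -/
abbrev ω (x : Vars n m k) : Herm n := x.1
/-- The variable `θ`. -/
abbrev θ (x : Vars n m k) : Herm n := x.2.1
/-- The variables `T_j` (numbered from `0`). -/
abbrev T (x : Vars n m k) : Fin m → Herm n := x.2.2.1
/-- The variables `Z_i`. -/
abbrev Z (x : Vars n m k) : Fin (k + 1) → Herm n := x.2.2.2

end Vars

/-- `[Z_i, Z_{i+1}; Z_{i+1}, I]`. -/
def sqrtBlock {n : Type*} [DecidableEq n] {m k : ℕ} (i : Fin k) (x : Vars n m k) :
    Matrix (n ⊕ n) (n ⊕ n) ℂ :=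
  Matrix.fromBlocks (x.Z i.castSucc) (x.Z i.succ) (x.Z i.succ) 1

/-- `[Z_k - I - T_j, -√t_j T_j; -√t_j T_j, I - t_j T_j]`. -/
def nodeBlock {n : Type*} [DecidableEq n] {m k : ℕ} (j : Fin m) (x : Vars n m k) :
    Matrix (n ⊕ n) (n ⊕ n) ℂ :=
  Matrix.fromBlocks
    (x.Z (Fin.last k) - 1 - x.T j)
    (-(Real.sqrt (gaussNode m j) • (x.T j : Matrix n n ℂ)))
    (-(Real.sqrt (gaussNode m j) • (x.T j : Matrix n n ℂ)))
    (1 - gaussNode m j • (x.T j : Matrix n n ℂ))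

/-- The semidefinite program that approximates the measured relative entropy with `k` square-root
steps and `m` quadrature nodes: maximize `Tr[θρ] - Tr[ωσ] + 1` over `ω > 0` and Hermitian
`θ, T_j, Z_i` with `Z₀ = ω`, `∑ⱼ wⱼ Tⱼ = 2^{-k} θ`, and `k + m` linear matrix inequalities of size
`2d × 2d`, where `d` is the number of elements of `n`. -/
def approxSDP {n : Type*} [Fintype n] [DecidableEq n] (ρ σ : Matrix n n ℂ) (m k : ℕ) :
    SemidefiniteProgram (Vars n m k) (Herm n × Herm n) n (Fin k ⊕ Fin m) (n ⊕ n) where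
  objective := affineOf (fun x => trMul x.θ ρ - trMul x.ω σ + 1)
    (by intro x y; simp [trMul, add_mul, Vars.ω, Vars.θ]; ring)
    (by intro c x; simp [trMul, Vars.ω, Vars.θ]; ring)
  pos := affineOf (fun x => (x.ω : Matrix n n ℂ)) (by intro x y; simp) (by intro c x; simp)
  eqn := affineOf
    (fun x => (x.Z 0 - x.ω, ∑ j, gaussWeight m j • x.T j - ((2 : ℝ) ^ k)⁻¹ • x.θ))
    (by
      intro x y
      refine Prod.ext ?_ ?_
      · simp [Vars.ω, Vars.θ, Vars.T, Vars.Z]; abel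
      · simp [Vars.ω, Vars.θ, Vars.T, Vars.Z, smul_add, Finset.sum_add_distrib]; abel)
    (by
      intro c x
      refine Prod.ext ?_ ?_
      · simp [Vars.ω, Vars.θ, Vars.T, Vars.Z, smul_sub]
      · simp [Vars.ω, Vars.θ, Vars.T, Vars.Z, smul_sub, Finset.smul_sum, smul_comm c])
  lmi := Sum.elim
    (fun i => affineOf (sqrtBlock i)
      (by
        intro x y
        ext a b
        rcases a with a | a <;> rcases b with b | b <;> simp [sqrtBlock, Vars.Z])
      (by
        intro c x
        ext a b
        rcases a with a | a <;> rcases b with b | b <;> simp [sqrtBlock, Vars.Z]))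
    (fun j => affineOf (nodeBlock j)
      (by
        intro x y
        ext a b
        rcases a with a | a <;> rcases b with b | b <;> simp [nodeBlock, Vars.T, Vars.Z] <;> ring)
      (by
        intro c x
        ext a b
        rcases a with a | a <;> rcases b with b | b <;> simp [nodeBlock, Vars.T, Vars.Z] <;> ring))

/-- The approximation of the measured relative entropy by the program above. -/
def measuredRelEntApprox {n : Type*} [Fintype n] [DecidableEq n] (ρ σ : Matrix n n ℂ)
    (m k : ℕ) : EReal :=
  (approxSDP ρ σ m k).value

end MeasuredRelEnt

end

/-!
The measured relative entropy and its semidefinite approximation are both compared with scalar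
problems, one for each measurement.

*Variational formula.* An admissible pair satisfies `θ ≤ ln ω`, so its value is at most
`Tr[ρ ln ω] - Tr[ωσ] + 1`. In an eigenbasis of `ω` this is `∑ p ln l - ∑ l q + 1`, with `l` the
eigenvalues of `ω`, and `ln z ≤ z - 1` bounds it by the relative entropy of the outcomes of the
projective measurement in that basis (`variational_le_measuredRelEnt`). Conversely, a measurement
`Λ` with outcome distributions `p`, `q` gives `ω = ∑ l(x) Λₓ`, where `l = max (p / q) δ`; the
operator Jensen inequality `∑ ln (l(x)) Λₓ ≤ ln ω` (`POVM.sum_log_mul_le_trMul_cfc_log`) then shows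
that the value is at least `∑ p ln (p / q)` up to `O(δ)`.

*The program.* Let `r` be the rational function `logApprox m k`, obtained from the quadrature of
`ln x = ∫₀¹ (x - 1) / (1 + t (x - 1)) dt` after `k` square roots. The matrix inequalities force
`Zᵢ ≤ ω ^ (1 / 2ⁱ)` and hence `Tr[θρ] ≤ Tr[r(ω) ρ]` (`trMul_theta_le`); this uses that the nodes
lie in `(0, 1)` and that the weights are nonnegative. In the other direction, for a measurement `Λ`
and positive numbers `l(x)`, all variables may be taken to be combinations of the `Λₓ` with the
scalar solutions for `l(x)`: every block is then a combination of the `Λₓ` with positive rank-one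
`2 × 2` coefficients (`POVM.vars_feasible`). These two facts, in the limit `m = k → ∞`, also prove
the operator Jensen inequality for the logarithm.

*Error.* The integrand is `1 / (t - s)` with `s = 1 / (1 - x)`. If `M` is the monic polynomial with
the nodes as roots, then `(M(t)² - M(s)²) / (t - s)` is a polynomial of degree less than `2m`, for
which the quadrature is exact, so that the quadrature error is the integral of
`M(t)² / (M(s)² (t - s))` (`nodal_sq_mul_log_sub_gaussLog`). Hence `r ≤ ln` on `[1, ∞)`, and the
error is at most `L (2L / 2ᵏ)²ᵐ` where `|ln x| ≤ L ≤ 2ᵏ` (`abs_logApprox_sub_log_le`). If the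
support of `ρ` lies in that of `σ`, then `ρ ≤ C σ`, so all ratios `p / q` are at most `C`, and
ratios and eigenvalues below `δ ∼ ε` may be truncated at the cost `δ Tr σ`. On `[δ, C]` one has
`L = O(ln (1 / ε))`, and `m = k ∼ √(ln (1 / ε))` makes the error at most `ε`.
-/

noncomputable section

namespace MeasuredRelEnt

/-! ### Gauss–Legendre quadrature -/

open Polynomial in
/-- Repeated integration by parts against the derivatives of `Xᵐ (1 - X)ᵐ`: the boundary terms
vanish because `0` and `1` are zeros of order `m`. -/
lemma integral_iterate_derivative_mul_eq_zero (m k : ℕ) (hk : k ≤ m) (q : ℝ[X])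
    (hq : derivative^[k] q = 0) :
    ∫ t in (0 : ℝ)..1, (derivative^[k] (X ^ m * (1 - X) ^ m : ℝ[X])).eval t * q.eval t = 0 := by
  induction k generalizing q with
  | zero => simp_all
  | succ k ih =>
    have hroot : ∀ x : ℝ, x = 0 ∨ x = 1 →
        (derivative^[k] (X ^ m * (1 - X) ^ m : ℝ[X])).eval x = 0 := by
      intro x hx
      have key : ∀ r : ℝ[X], r ^ m ∣ (X ^ m * (1 - X) ^ m : ℝ[X]) → r.eval x = 0 →
          (derivative^[k] (X ^ m * (1 - X) ^ m : ℝ[X])).eval x = 0 := by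
        intro r hr h0
        obtain ⟨s, hs⟩ := pow_sub_dvd_iterate_derivative_of_pow_dvd k hr
        rw [hs, eval_mul, eval_pow, h0, zero_pow (by omega), zero_mul]
      rcases hx with rfl | rfl
      · exact key X (Dvd.intro _ rfl) (by simp)
      · exact key (1 - X) (Dvd.intro_left _ rfl) (by simp)
    have ibp := intervalIntegral.integral_mul_deriv_eq_deriv_mul (a := (0 : ℝ)) (b := 1)
      (u := fun t => q.eval t)
      (v := fun t => (derivative^[k] (X ^ m * (1 - X) ^ m : ℝ[X])).eval t)
      (u' := fun t => q.derivative.eval t)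
      (v' := fun t => (derivative^[k + 1] (X ^ m * (1 - X) ^ m : ℝ[X])).eval t)
      (fun t _ => q.hasDerivAt t)
      (fun t _ => by
        rw [Function.iterate_succ_apply']
        exact Polynomial.hasDerivAt _ t)
      ((Polynomial.continuous _).intervalIntegrable _ _)
      ((Polynomial.continuous _).intervalIntegrable _ _)
    have h' := ih (by omega) q.derivative (by rwa [← Function.iterate_succ_apply])
    simp only [hroot 0 (.inl rfl), hroot 1 (.inr rfl), mul_zero, sub_self, zero_sub] at ibp
    simp only [mul_comm] at ibp h' ⊢
    rw [ibp, h', neg_zero]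

/-- The `m`-th shifted Legendre polynomial with real coefficients. -/
def legendreReal (m : ℕ) : Polynomial ℝ :=
  (Polynomial.shiftedLegendre m).map (Int.castRingHom ℝ)

lemma degree_legendreReal (m : ℕ) : (legendreReal m).degree = m := by
  rw [legendreReal, Polynomial.degree_map_eq_of_injective (RingHom.injective_int _),
    Polynomial.degree_shiftedLegendre]

lemma legendreReal_ne_zero (m : ℕ) : legendreReal m ≠ 0 := by
  intro h
  simpa [h] using degree_legendreReal m

open Polynomial in
lemma integral_legendreReal_mul_eq_zero (m : ℕ) (q : ℝ[X]) (hq : q.degree < m) :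
    ∫ t in (0 : ℝ)..1, (legendreReal m).eval t * q.eval t = 0 := by
  have h := integral_iterate_derivative_mul_eq_zero m m le_rfl q
    (iterate_derivative_eq_zero_of_degree_lt hq)
  have hR := congrArg (Polynomial.map (Int.castRingHom ℝ)) (factorial_mul_shiftedLegendre_eq m)
  rw [← Polynomial.iterate_derivative_map] at hR
  simp only [Polynomial.map_mul, Polynomial.map_natCast, Polynomial.map_pow, Polynomial.map_sub,
    Polynomial.map_one, Polynomial.map_X] at hR
  rw [← hR] at h
  simp only [eval_mul, eval_natCast, mul_assoc] at h
  rw [intervalIntegral.integral_const_mul] at h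
  exact (mul_eq_zero.mp h).resolve_left (by positivity)

open Polynomial in
/-- A real polynomial stops changing sign on `(0, 1)` once it is multiplied by the linear factors
of suitable distinct roots, namely those of odd multiplicity. -/
lemma exists_finset_roots_mul_prod_sign (d : ℕ) (p : ℝ[X]) (hp : p ≠ 0) (hd : p.natDegree = d) :
    ∃ S : Finset ℝ, S ⊆ p.roots.toFinset ∧ (∀ r ∈ S, r ∈ Set.Ioo (0 : ℝ) 1) ∧
      ((∀ x ∈ Set.Ioo (0 : ℝ) 1, 0 ≤ (p * ∏ r ∈ S, (X - C r)).eval x) ∨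
        ∀ x ∈ Set.Ioo (0 : ℝ) 1, (p * ∏ r ∈ S, (X - C r)).eval x ≤ 0) := by
  induction d generalizing p with
  | zero =>
    rw [eq_C_of_natDegree_eq_zero hd]
    refine ⟨∅, by simp, by simp, ?_⟩
    rcases le_total 0 (p.coeff 0) with h | h <;> simp [h]
  | succ d ih =>
    by_cases hroot : ∃ r ∈ Set.Ioo (0 : ℝ) 1, p.IsRoot r
    · obtain ⟨r, hr, hpr⟩ := hroot
      obtain ⟨q, rfl⟩ := dvd_iff_isRoot.mpr hpr
      have hq : q ≠ 0 := right_ne_zero_of_mul hp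
      have hqd : q.natDegree = d := by
        rw [natDegree_mul (X_sub_C_ne_zero r) hq, natDegree_X_sub_C] at hd
        omega
      obtain ⟨S, hS, hS01, hsign⟩ := ih q hq hqd
      have hroots : ((X - C r) * q).roots.toFinset = insert r q.roots.toFinset := by
        rw [roots_mul hp, roots_X_sub_C]
        ext
        simp
      by_cases hrS : r ∈ S
      · refine ⟨S.erase r, ?_, fun s hs => hS01 s (Finset.mem_of_mem_erase hs), ?_⟩
        · rw [hroots]
          exact (Finset.erase_subset _ _).trans (hS.trans (Finset.subset_insert _ _))
        · have : (X - C r) * q * ∏ s ∈ S.erase r, (X - C s) = q * ∏ s ∈ S, (X - C s) := by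
            rw [← Finset.mul_prod_erase S _ hrS]
            ring
          rwa [this]
      · refine ⟨insert r S, ?_, ?_, ?_⟩
        · rw [hroots]
          exact Finset.insert_subset_insert _ hS
        · intro s hs
          rcases Finset.mem_insert.mp hs with rfl | hs
          · exact hr
          · exact hS01 s hs
        · have : (X - C r) * q * ∏ s ∈ insert r S, (X - C s) =
              (X - C r) ^ 2 * (q * ∏ s ∈ S, (X - C s)) := by
            rw [Finset.prod_insert hrS]
            ring
          rw [this]
          refine hsign.imp (fun h x hx => ?_) (fun h x hx => ?_) <;> rw [eval_mul, eval_pow]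
          · exact mul_nonneg (sq_nonneg _) (h x hx)
          · exact mul_nonpos_of_nonneg_of_nonpos (sq_nonneg _) (h x hx)
    · push Not at hroot
      refine ⟨∅, by simp, by simp, ?_⟩
      by_contra! hcon
      obtain ⟨⟨x, hx, hx'⟩, y, hy, hy'⟩ := hcon
      simp only [Finset.prod_empty, mul_one] at hx' hy'
      obtain ⟨z, hz, hz'⟩ := isPreconnected_Ioo.intermediate_value hx hy
        p.continuous.continuousOn ⟨hx'.le, hy'.le⟩
      exact hroot z hz hz'

open Polynomial in
/-- The Legendre polynomial has `m` distinct roots in `(0, 1)`: otherwise it would fail to be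
orthogonal to the product of the linear factors at its sign changes. -/
lemma exists_roots_legendreReal (m : ℕ) :
    ∃ S : Finset ℝ, S.card = m ∧ S.val = (legendreReal m).roots ∧
      ∀ r ∈ S, r ∈ Set.Ioo (0 : ℝ) 1 := by
  have hP := legendreReal_ne_zero m
  have hdeg : (legendreReal m).natDegree = m :=
    natDegree_eq_of_degree_eq_some (degree_legendreReal m)
  obtain ⟨S, hS, hS01, hsign⟩ := exists_finset_roots_mul_prod_sign _ (legendreReal m) hP rfl
  have hle : S.val ≤ (legendreReal m).roots :=
    Multiset.le_iff_subset S.nodup |>.mpr fun x hx => Multiset.mem_toFinset.mp (hS hx)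
  have hroots : Multiset.card (legendreReal m).roots ≤ m := (card_roots' _).trans hdeg.le
  have hcard : m ≤ S.card := by
    by_contra! hlt
    have hint := integral_legendreReal_mul_eq_zero m (∏ r ∈ S, (X - C r)) (by
      have := Lagrange.degree_nodal (R := ℝ) (s := S) (v := id)
      rw [Lagrange.nodal_eq] at this
      simp only [id_eq] at this
      rw [this]
      exact_mod_cast hlt)
    set f : ℝ[X] := legendreReal m * ∏ r ∈ S, (X - C r) with hf
    have hf0 : f ≠ 0 := mul_ne_zero hP (Finset.prod_ne_zero_iff.mpr fun r _ => X_sub_C_ne_zero r)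
    simp only [← eval_mul, ← hf] at hint
    have hmain : ∀ g : ℝ[X], g ≠ 0 → (∀ x ∈ Set.Ioo (0 : ℝ) 1, 0 ≤ g.eval x) →
        ∫ t in (0 : ℝ)..1, g.eval t ≠ 0 := by
      intro g hg hpos
      have hcl : ∀ x ∈ Set.Icc (0 : ℝ) 1, 0 ≤ g.eval x := by
        intro x hx
        rw [← closure_Ioo (zero_ne_one' ℝ)] at hx
        exact closure_minimal (s := Set.Ioo (0 : ℝ) 1) (t := {x | 0 ≤ g.eval x}) hpos
          (isClosed_le continuous_const g.continuous) hx
      obtain ⟨c, hc, hgc⟩ : ∃ c ∈ Set.Icc (0 : ℝ) 1, g.eval c ≠ 0 := by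
        by_contra! h
        exact hg (eq_zero_of_infinite_isRoot g
          ((Set.Icc_infinite (zero_lt_one' ℝ)).mono fun x hx => h x hx))
      exact (intervalIntegral.integral_pos zero_lt_one g.continuous.continuousOn
        (fun x hx => hcl x (Set.Ioc_subset_Icc_self hx))
        ⟨c, hc, lt_of_le_of_ne (hcl c hc) hgc.symm⟩).ne'
    rcases hsign with h | h
    · exact hmain f hf0 h hint
    · refine hmain (-f) (neg_ne_zero.mpr hf0) (fun x hx => ?_) ?_
      · rw [eval_neg]
        exact neg_nonneg.mpr (h x hx)
      · simp [hint]
  have heq : S.val = (legendreReal m).roots :=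
    Multiset.eq_of_le_of_card_le hle (hroots.trans hcard)
  exact ⟨S, le_antisymm (by rw [← heq] at hroots; exact hroots) hcard, heq, hS01⟩

lemma exists_gaussNode_eq (m : ℕ) :
    ∃ S : Finset ℝ, S.val = (legendreReal m).roots ∧ (∀ r ∈ S, r ∈ Set.Ioo (0 : ℝ) 1) ∧
      Function.Injective (gaussNode m) ∧ ∀ j, gaussNode m j ∈ S := by
  obtain ⟨S, hcard, hS, h01⟩ := exists_roots_legendreReal m
  have hlen : (S.sort (· ≤ ·)).length = m := by rw [Finset.length_sort, hcard]
  have hget : ∀ j : Fin m, gaussNode m j =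
      (S.sort (· ≤ ·)).get ⟨j, by rw [hlen]; exact j.2⟩ := by
    intro j
    rw [gaussNode, ← legendreReal, ← hS, Finset.sort_val,
      List.getD_eq_getElem _ _ (by rw [hlen]; exact j.2)]
    rfl
  refine ⟨S, hS, h01, fun i j hij => ?_, fun j => ?_⟩
  · rw [hget, hget] at hij
    have := (List.nodup_iff_injective_get.mp (S.sort_nodup (· ≤ ·))) hij
    exact Fin.ext (Fin.mk.inj_iff.mp this)
  · rw [hget]
    exact (Finset.mem_sort _).mp (List.get_mem _ _)

lemma gaussNode_mem_Ioo {m : ℕ} (j : Fin m) : gaussNode m j ∈ Set.Ioo (0 : ℝ) 1 := by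
  obtain ⟨S, -, h01, -, h⟩ := exists_gaussNode_eq m
  exact h01 _ (h j)

lemma gaussNode_injective (m : ℕ) : Function.Injective (gaussNode m) := by
  obtain ⟨S, -, -, h, -⟩ := exists_gaussNode_eq m
  exact h

lemma eval_legendreReal_gaussNode {m : ℕ} (j : Fin m) :
    (legendreReal m).eval (gaussNode m j) = 0 := by
  obtain ⟨S, hS, -, -, h⟩ := exists_gaussNode_eq m
  have : gaussNode m j ∈ (legendreReal m).roots := hS ▸ h j
  exact (Polynomial.mem_roots'.mp this).2

open Polynomial in
/-- Gauss–Legendre quadrature with `m` nodes is exact for polynomials of degree less than `2m`: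
division by the Legendre polynomial leaves a remainder that interpolates at the nodes and a
multiple of the Legendre polynomial that integrates to zero. -/
lemma sum_gaussWeight_mul_eval (m : ℕ) (g : ℝ[X]) (hg : g.degree < (2 * m : ℕ)) :
    ∑ j, gaussWeight m j * g.eval (gaussNode m j) = ∫ t in (0 : ℝ)..1, g.eval t := by
  set P := legendreReal m
  have hP : P ≠ 0 := legendreReal_ne_zero m
  have hinj : Set.InjOn (gaussNode m) (Finset.univ : Finset (Fin m)) :=
    (gaussNode_injective m).injOn
  have hmod : (g % P).degree < m := degree_legendreReal m ▸ degree_mod_lt g hP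
  have hdiv : (g / P).degree < m := by
    rcases lt_or_ge g.degree P.degree with h | h
    · rw [(Polynomial.div_eq_zero_iff hP).mpr h, degree_zero]
      exact WithBot.bot_lt_coe m
    · by_cases hgP : g / P = 0
      · rw [hgP, degree_zero]
        exact WithBot.bot_lt_coe m
      have := degree_add_div hP h
      rw [degree_legendreReal m, degree_eq_natDegree hgP] at this
      rw [← this] at hg
      rw [degree_eq_natDegree hgP]
      norm_cast at hg ⊢
      omega
  have hdecomp : ∀ t, g.eval t = P.eval t * (g / P).eval t + (g % P).eval t := by
    intro t
    conv_lhs => rw [← EuclideanDomain.div_add_mod g P]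
    simp
  have hinterp := Lagrange.eq_interpolate (s := Finset.univ) (f := g % P) hinj (by simpa using hmod)
  have hnode : ∀ j, (g % P).eval (gaussNode m j) = g.eval (gaussNode m j) := by
    intro j
    rw [hdecomp (gaussNode m j), eval_legendreReal_gaussNode, zero_mul, zero_add]
  have hrem : ∫ t in (0 : ℝ)..1, (g % P).eval t =
      ∑ j, gaussWeight m j * g.eval (gaussNode m j) := by
    have : ∀ t, (g % P).eval t = ∑ j, g.eval (gaussNode m j) *
        (Lagrange.basis Finset.univ (gaussNode m) j).eval t := by
      intro t
      conv_lhs => rw [hinterp, Lagrange.interpolate_apply, eval_finsetSum]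
      simp [hnode]
    simp_rw [this]
    have hi : ∀ j ∈ Finset.univ, IntervalIntegrable (fun t => g.eval (gaussNode m j) *
        (Lagrange.basis Finset.univ (gaussNode m) j).eval t) MeasureTheory.volume 0 1 :=
      fun j _ => (continuous_const.mul (Polynomial.continuous _)).intervalIntegrable _ _
    rw [intervalIntegral.integral_finsetSum hi]
    refine Finset.sum_congr rfl fun j _ => ?_
    rw [intervalIntegral.integral_const_mul, gaussWeight, mul_comm]
  have hint : ∀ q : ℝ[X], IntervalIntegrable (fun t => q.eval t) MeasureTheory.volume 0 1 :=
    fun q => q.continuous.intervalIntegrable _ _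
  simp_rw [hdecomp]
  rw [intervalIntegral.integral_add (by simpa using hint (P * (g / P))) (hint _),
    integral_legendreReal_mul_eq_zero m _ hdiv, zero_add, hrem]
  simp_rw [← hdecomp]

open Polynomial in
/-- The weight is the integral of the square of the Lagrange basis polynomial, because the
quadrature is exact for this square. -/
lemma gaussWeight_nonneg {m : ℕ} (j : Fin m) : 0 ≤ gaussWeight m j := by
  set ℓ := Lagrange.basis Finset.univ (gaussNode m) j
  have hinj : Set.InjOn (gaussNode m) (Finset.univ : Finset (Fin m)) :=
    (gaussNode_injective m).injOn
  have hdeg : (ℓ * ℓ).degree < (2 * m : ℕ) := by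
    have hm := j.pos
    rw [degree_mul, Lagrange.degree_basis hinj (Finset.mem_univ j), Finset.card_univ,
      Fintype.card_fin]
    norm_cast
    omega
  have h := sum_gaussWeight_mul_eval m (ℓ * ℓ) hdeg
  rw [Finset.sum_eq_single j] at h
  · rw [eval_mul, Lagrange.eval_basis_self hinj (Finset.mem_univ j), mul_one, mul_one] at h
    rw [h]
    exact intervalIntegral.integral_nonneg zero_le_one fun t _ => by
      rw [eval_mul]
      exact mul_self_nonneg _
  · intro i _ hij
    rw [eval_mul, Lagrange.eval_basis_of_ne hij.symm (Finset.mem_univ i), mul_zero, mul_zero]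
  · simp

/-! ### Rational approximation of the logarithm -/

/-- The integrand of `ln x = ∫₀¹ (x - 1) / (1 + t (x - 1)) dt`. -/
def logIntegrand (t x : ℝ) : ℝ := (x - 1) / (1 + t * (x - 1))

/-- The `m`-point Gauss–Legendre quadrature of `ln x = ∫₀¹ (x - 1) / (1 + t (x - 1)) dt`. -/
def gaussLog (m : ℕ) (x : ℝ) : ℝ := ∑ j, gaussWeight m j * logIntegrand (gaussNode m j) x

/-- The approximation of `ln x = 2ᵏ ln (x ^ (1 / 2ᵏ))` by quadrature after `k` square roots. -/
def logApprox (m k : ℕ) (x : ℝ) : ℝ := 2 ^ k * gaussLog m (Real.sqrt^[k] x)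

lemma one_add_mul_sub_one_pos {t x : ℝ} (ht : t ∈ Set.Icc (0 : ℝ) 1) (hx : 0 < x) :
    0 < 1 + t * (x - 1) := by
  rcases le_total x 1 with h | h
  · nlinarith [mul_le_mul_of_nonneg_right ht.2 (sub_nonneg.mpr h)]
  · nlinarith [mul_nonneg ht.1 (sub_nonneg.mpr h)]

lemma gaussNode_mem_Icc {m : ℕ} (j : Fin m) : gaussNode m j ∈ Set.Icc (0 : ℝ) 1 :=
  Set.Ioo_subset_Icc_self (gaussNode_mem_Ioo j)

lemma logIntegrand_mono {t x y : ℝ} (ht : t ∈ Set.Icc (0 : ℝ) 1) (hx : 0 < x) (hxy : x ≤ y) :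
    logIntegrand t x ≤ logIntegrand t y := by
  rw [logIntegrand, logIntegrand, div_le_div_iff₀ (one_add_mul_sub_one_pos ht hx)
    (one_add_mul_sub_one_pos ht (hx.trans_le hxy))]
  nlinarith

lemma gaussLog_mono {m : ℕ} {x y : ℝ} (hx : 0 < x) (hxy : x ≤ y) : gaussLog m x ≤ gaussLog m y :=
  Finset.sum_le_sum fun j _ => mul_le_mul_of_nonneg_left
    (logIntegrand_mono (gaussNode_mem_Icc j) hx hxy) (gaussWeight_nonneg j)

lemma continuousOn_logIntegrand {x : ℝ} (hx : 0 < x) :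
    ContinuousOn (fun t => logIntegrand t x) (Set.Icc 0 1) := by
  unfold logIntegrand
  exact continuousOn_const.div (by fun_prop) fun t ht => (one_add_mul_sub_one_pos ht hx).ne'

lemma integral_logIntegrand {x : ℝ} (hx : 0 < x) :
    ∫ t in (0 : ℝ)..1, logIntegrand t x = Real.log x := by
  have h := intervalIntegral.integral_eq_sub_of_hasDerivAt (a := 0) (b := 1)
    (f := fun t => Real.log (1 + t * (x - 1))) (f' := fun t => logIntegrand t x)
    (fun t ht => by
      rw [Set.uIcc_of_le zero_le_one] at ht
      have hd : HasDerivAt (fun t : ℝ => 1 + t * (x - 1)) (x - 1) t := by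
        simpa using ((hasDerivAt_id t).mul_const (x - 1)).const_add 1
      exact hd.log (one_add_mul_sub_one_pos ht hx).ne')
    (by
      apply ContinuousOn.intervalIntegrable
      rw [Set.uIcc_of_le zero_le_one]
      exact continuousOn_logIntegrand hx)
  simpa using h

lemma inv_one_sub_sub_eq {t x : ℝ} (hx1 : x ≠ 1) :
    (1 - x)⁻¹ - t = (1 + t * (x - 1)) / (1 - x) := by
  have : 1 - x ≠ 0 := sub_ne_zero.mpr hx1.symm
  field_simp
  ring

open Polynomial in
/-- The exact quadrature error. The integrand has its pole at `s = 1 / (1 - x)`; multiplying it by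
`M(t)² - M(s)²`, where `M` is the monic polynomial that vanishes at the nodes, removes the pole and
leaves a polynomial of degree less than `2m`, for which the quadrature is exact. -/
lemma nodal_sq_mul_log_sub_gaussLog (m : ℕ) {x : ℝ} (hx : 0 < x) (hx1 : x ≠ 1) :
    (Lagrange.nodal Finset.univ (gaussNode m)).eval (1 - x)⁻¹ ^ 2 *
        (Real.log x - gaussLog m x) =
      ∫ t in (0 : ℝ)..1, logIntegrand t x *
        (Lagrange.nodal Finset.univ (gaussNode m)).eval t ^ 2 := by
  set M := Lagrange.nodal Finset.univ (gaussNode m) with hM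
  set s := (1 - x)⁻¹ with hs
  have hx0 : 1 - x ≠ 0 := sub_ne_zero.mpr hx1.symm
  obtain ⟨q, hq⟩ := X_sub_C_dvd_sub_C_eval (a := s) (p := M ^ 2)
  have hqe : ∀ t ∈ Set.Icc (0 : ℝ) 1,
      logIntegrand t x * M.eval t ^ 2 - M.eval s ^ 2 * logIntegrand t x = q.eval t := by
    intro t ht
    have h1 := congrArg (eval t) hq
    simp only [eval_sub, eval_pow, eval_C, eval_mul, eval_X] at h1
    have hpos := (one_add_mul_sub_one_pos ht hx).ne'
    have hts : logIntegrand t x * (t - s) = 1 := by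
      rw [← neg_sub s t, hs, inv_one_sub_sub_eq hx1, logIntegrand]
      generalize 1 + t * (x - 1) = D at hpos
      field_simp
      ring
    calc _ = logIntegrand t x * (M.eval t ^ 2 - M.eval s ^ 2) := by ring
      _ = logIntegrand t x * (t - s) * q.eval t := by rw [h1]; ring
      _ = q.eval t := by rw [hts, one_mul]
  have hdeg : q.degree < (2 * m : ℕ) := by
    by_cases hq0 : q = 0
    · rw [hq0, degree_zero]
      exact WithBot.bot_lt_coe _
    have h2 : (M ^ 2).natDegree = 2 * m := by
      rw [natDegree_pow, hM, Lagrange.natDegree_nodal, Finset.card_univ, Fintype.card_fin]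
    have h3 := congrArg natDegree hq
    rw [natDegree_sub_C, h2, natDegree_mul (X_sub_C_ne_zero s) hq0, natDegree_X_sub_C] at h3
    rw [degree_eq_natDegree hq0]
    norm_cast
    omega
  have hquad := sum_gaussWeight_mul_eval m q hdeg
  have hsum : ∑ j, gaussWeight m j * q.eval (gaussNode m j) = -(M.eval s ^ 2 * gaussLog m x) := by
    rw [gaussLog, Finset.mul_sum, ← Finset.sum_neg_distrib]
    refine Finset.sum_congr rfl fun j _ => ?_
    rw [← hqe _ (gaussNode_mem_Icc j), hM, Lagrange.eval_nodal_at_node (Finset.mem_univ j)]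
    ring
  have hcont := continuousOn_logIntegrand hx
  have hint : IntervalIntegrable (fun t => logIntegrand t x) MeasureTheory.volume 0 1 := by
    apply ContinuousOn.intervalIntegrable
    rwa [Set.uIcc_of_le zero_le_one]
  have hint' : IntervalIntegrable (fun t => logIntegrand t x * M.eval t ^ 2)
      MeasureTheory.volume 0 1 := by
    apply ContinuousOn.intervalIntegrable
    rw [Set.uIcc_of_le zero_le_one]
    exact hcont.mul (M.continuous.pow 2).continuousOn
  have hcongr : ∫ t in (0 : ℝ)..1, q.eval t = ∫ t in (0 : ℝ)..1,
      (logIntegrand t x * M.eval t ^ 2 - M.eval s ^ 2 * logIntegrand t x) := by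
    refine intervalIntegral.integral_congr fun t ht => ?_
    rw [Set.uIcc_of_le zero_le_one] at ht
    exact (hqe t ht).symm
  rw [hsum, hcongr, intervalIntegral.integral_sub hint' (hint.const_mul _),
    intervalIntegral.integral_const_mul, integral_logIntegrand hx] at hquad
  linarith

open Polynomial in
/-- The monic polynomial with the nodes as roots is large at the pole `1 / (1 - x)`, because `x`
close to `1` puts this pole far away from `[0, 1]`. -/
lemma one_le_pow_mul_nodal_sq (m : ℕ) {x u : ℝ} (hx : 0 < x) (hx1 : x ≠ 1)
    (hu : |Real.log x| ≤ u) :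
    1 ≤ (Real.exp u - 1) ^ (2 * m) *
      (Lagrange.nodal Finset.univ (gaussNode m)).eval (1 - x)⁻¹ ^ 2 := by
  have hxe : x ≤ Real.exp u := by
    rw [← Real.exp_log hx]
    exact Real.exp_le_exp.mpr ((le_abs_self _).trans hu)
  have hxe' : 1 ≤ Real.exp u * x := by
    have : Real.exp (-u) ≤ x := by
      rw [← Real.exp_log hx]
      exact Real.exp_le_exp.mpr (neg_le.mp ((neg_le_abs _).trans hu))
    calc (1 : ℝ) = Real.exp u * Real.exp (-u) := by rw [← Real.exp_add]; simp
      _ ≤ _ := mul_le_mul_of_nonneg_left this (Real.exp_pos _).le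
  have he : 0 ≤ Real.exp u - 1 := by
    have := Real.add_one_le_exp u
    linarith [(abs_nonneg _).trans hu]
  have hfac : ∀ j : Fin m, 1 ≤ (Real.exp u - 1) * |(1 - x)⁻¹ - gaussNode m j| := by
    intro j
    have ht := gaussNode_mem_Icc j
    have hpos := one_add_mul_sub_one_pos ht hx
    rw [inv_one_sub_sub_eq hx1, abs_div, abs_of_pos hpos, ← mul_div_assoc,
      one_le_div (abs_pos.mpr (sub_ne_zero.mpr hx1.symm))]
    rcases le_total x 1 with h | h
    · rw [abs_of_nonneg (sub_nonneg.mpr h)]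
      have : x ≤ 1 + gaussNode m j * (x - 1) := by nlinarith [ht.2]
      nlinarith
    · rw [abs_of_nonpos (sub_nonpos.mpr h)]
      have : 1 ≤ 1 + gaussNode m j * (x - 1) := by nlinarith [ht.1]
      nlinarith
  have hprod : 1 ≤ ∏ j : Fin m, ((Real.exp u - 1) * |(1 - x)⁻¹ - gaussNode m j|) :=
    Finset.one_le_prod fun j _ => hfac j
  rw [Finset.prod_mul_distrib, Finset.prod_const, Finset.card_univ, Fintype.card_fin,
    ← Finset.abs_prod, ← Lagrange.eval_nodal] at hprod
  calc (1 : ℝ) ≤ ((Real.exp u - 1) ^ m *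
        |(Lagrange.nodal Finset.univ (gaussNode m)).eval (1 - x)⁻¹|) ^ 2 := one_le_pow₀ hprod
    _ = _ := by rw [mul_pow, sq_abs, ← pow_mul, mul_comm m 2]

open Polynomial in
lemma nodal_sq_le_one {m : ℕ} {t : ℝ} (ht : t ∈ Set.Icc (0 : ℝ) 1) :
    (Lagrange.nodal Finset.univ (gaussNode m)).eval t ^ 2 ≤ 1 := by
  rw [← sq_abs, Lagrange.eval_nodal, Finset.abs_prod]
  refine pow_le_one₀ (Finset.prod_nonneg fun _ _ => abs_nonneg _)
    (Finset.prod_le_one (fun _ _ => abs_nonneg _) fun j _ => ?_)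
  have := gaussNode_mem_Icc j
  rw [abs_le]
  constructor <;> linarith [ht.1, ht.2, this.1, this.2]

lemma gaussLog_one (m : ℕ) : gaussLog m 1 = 0 := by simp [gaussLog, logIntegrand]

lemma gaussLog_le_log (m : ℕ) {x : ℝ} (hx : 1 ≤ x) : gaussLog m x ≤ Real.log x := by
  rcases hx.eq_or_lt with rfl | hx1
  · simp [gaussLog_one]
  have hx0 : 0 < x := zero_lt_one.trans hx1
  have hM := one_le_pow_mul_nodal_sq m hx0 hx1.ne' le_rfl
  have hpos : 0 < (Lagrange.nodal Finset.univ (gaussNode m)).eval (1 - x)⁻¹ ^ 2 := by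
    rw [sq_pos_iff]
    rintro h
    rw [h] at hM
    norm_num at hM
  have h := nodal_sq_mul_log_sub_gaussLog m hx0 hx1.ne'
  have hint : 0 ≤ ∫ t in (0 : ℝ)..1, logIntegrand t x *
      (Lagrange.nodal Finset.univ (gaussNode m)).eval t ^ 2 :=
    intervalIntegral.integral_nonneg zero_le_one fun t ht =>
      mul_nonneg (div_nonneg (by linarith) (one_add_mul_sub_one_pos ht hx0).le) (sq_nonneg _)
  rw [← h] at hint
  exact sub_nonneg.mp (nonneg_of_mul_nonneg_right hint hpos)

lemma abs_log_sub_gaussLog_le (m : ℕ) {x u : ℝ} (hx : 0 < x) (hu : |Real.log x| ≤ u) :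
    |Real.log x - gaussLog m x| ≤ |Real.log x| * (Real.exp u - 1) ^ (2 * m) := by
  by_cases hx1 : x = 1
  · simp [hx1, gaussLog_one]
  have hM := one_le_pow_mul_nodal_sq m hx hx1 hu
  have h := nodal_sq_mul_log_sub_gaussLog m hx hx1
  set A := (Lagrange.nodal Finset.univ (gaussNode m)).eval (1 - x)⁻¹ ^ 2
  have hA : 0 ≤ A := sq_nonneg _
  have hcont : ContinuousOn (fun t => logIntegrand t x *
      (Lagrange.nodal Finset.univ (gaussNode m)).eval t ^ 2) (Set.uIcc 0 1) := by
    rw [Set.uIcc_of_le zero_le_one]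
    exact (continuousOn_logIntegrand hx).mul ((Polynomial.continuous _).pow 2).continuousOn
  have hcont' : ContinuousOn (fun t => logIntegrand t x) (Set.uIcc 0 1) := by
    rw [Set.uIcc_of_le zero_le_one]
    exact continuousOn_logIntegrand hx
  -- The integrand has the sign of `x - 1`, so the factor `M(t)² ≤ 1` only shrinks the integral.
  have hle : |∫ t in (0 : ℝ)..1, logIntegrand t x *
      (Lagrange.nodal Finset.univ (gaussNode m)).eval t ^ 2| ≤ |Real.log x| := by
    rw [← integral_logIntegrand hx]
    rcases le_total 1 x with h1 | h1
    · have hf : ∀ t ∈ Set.Icc (0 : ℝ) 1, 0 ≤ logIntegrand t x := fun t ht =>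
        div_nonneg (by linarith) (one_add_mul_sub_one_pos ht hx).le
      rw [abs_of_nonneg (intervalIntegral.integral_nonneg zero_le_one hf), abs_of_nonneg
        (intervalIntegral.integral_nonneg zero_le_one fun t ht =>
          mul_nonneg (hf t ht) (sq_nonneg _))]
      exact intervalIntegral.integral_mono_on zero_le_one hcont.intervalIntegrable
        hcont'.intervalIntegrable fun t ht =>
          mul_le_of_le_one_right (hf t ht) (nodal_sq_le_one ht)
    · have hf : ∀ t ∈ Set.Icc (0 : ℝ) 1, 0 ≤ -logIntegrand t x := fun t ht =>
        neg_nonneg.mpr (div_nonpos_of_nonpos_of_nonneg (by linarith)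
          (one_add_mul_sub_one_pos ht hx).le)
      rw [← abs_neg, ← abs_neg (∫ t in (0 : ℝ)..1, logIntegrand t x),
        ← intervalIntegral.integral_neg, ← intervalIntegral.integral_neg,
        abs_of_nonneg (intervalIntegral.integral_nonneg zero_le_one hf), abs_of_nonneg
        (intervalIntegral.integral_nonneg zero_le_one fun t ht => by
          rw [← neg_mul]
          exact mul_nonneg (hf t ht) (sq_nonneg _))]
      exact intervalIntegral.integral_mono_on zero_le_one hcont.neg.intervalIntegrable
        hcont'.neg.intervalIntegrable fun t ht => by
          rw [← neg_mul]
          exact mul_le_of_le_one_right (hf t ht) (nodal_sq_le_one ht)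
  rw [← h, abs_mul, abs_of_nonneg hA] at hle
  have he : 0 ≤ (Real.exp u - 1) ^ (2 * m) := (even_two_mul m).pow_nonneg _
  calc |Real.log x - gaussLog m x|
      ≤ ((Real.exp u - 1) ^ (2 * m) * A) * |Real.log x - gaussLog m x| :=
        le_mul_of_one_le_left (abs_nonneg _) hM
    _ = (A * |Real.log x - gaussLog m x|) * (Real.exp u - 1) ^ (2 * m) := by ring
    _ ≤ _ := mul_le_mul_of_nonneg_right hle he

lemma iterate_sqrt_pos {x : ℝ} (hx : 0 < x) (k : ℕ) : 0 < Real.sqrt^[k] x := by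
  induction k with
  | zero => simpa
  | succ k ih =>
    rw [Function.iterate_succ_apply']
    exact Real.sqrt_pos.mpr ih

lemma iterate_sqrt_mono (k : ℕ) : Monotone (Real.sqrt^[k]) :=
  Monotone.iterate (fun _ _ => Real.sqrt_le_sqrt) k

lemma log_iterate_sqrt {x : ℝ} (hx : 0 < x) (k : ℕ) :
    Real.log (Real.sqrt^[k] x) = Real.log x / 2 ^ k := by
  induction k with
  | zero => simp
  | succ k ih =>
    rw [Function.iterate_succ_apply', Real.log_sqrt (iterate_sqrt_pos hx k).le, ih, pow_succ,
      div_div]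

lemma logApprox_mono (m k : ℕ) {x y : ℝ} (hx : 0 < x) (hxy : x ≤ y) :
    logApprox m k x ≤ logApprox m k y :=
  mul_le_mul_of_nonneg_left (gaussLog_mono (iterate_sqrt_pos hx k) (iterate_sqrt_mono k hxy))
    (by positivity)

lemma logApprox_le_log (m k : ℕ) {x : ℝ} (hx : 1 ≤ x) : logApprox m k x ≤ Real.log x := by
  have hroot : 1 ≤ Real.sqrt^[k] x := by
    have := iterate_sqrt_mono k hx
    rwa [Function.iterate_fixed Real.sqrt_one] at this
  calc logApprox m k x ≤ 2 ^ k * Real.log (Real.sqrt^[k] x) :=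
        mul_le_mul_of_nonneg_left (gaussLog_le_log m hroot) (by positivity)
    _ = Real.log x := by
        rw [log_iterate_sqrt (zero_lt_one.trans_le hx)]
        field_simp

/-- The square roots shrink `ln x` by the factor `2ᵏ`, and the quadrature error is of order `2m + 1`
in the logarithm of its argument. -/
lemma abs_logApprox_sub_log_le (m k : ℕ) {x L : ℝ} (hx : 0 < x) (hL : |Real.log x| ≤ L)
    (hLk : L ≤ 2 ^ k) :
    |logApprox m k x - Real.log x| ≤ L * (2 * L / 2 ^ k) ^ (2 * m) := by
  have h2 : (0 : ℝ) < 2 ^ k := by positivity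
  have hL0 : 0 ≤ L := (abs_nonneg _).trans hL
  have habs : |Real.log (Real.sqrt^[k] x)| = |Real.log x| / 2 ^ k := by
    rw [log_iterate_sqrt hx, abs_div, abs_of_pos h2]
  have hu : |Real.log (Real.sqrt^[k] x)| ≤ L / 2 ^ k := by
    rw [habs]
    gcongr
  have h := abs_log_sub_gaussLog_le m (iterate_sqrt_pos hx k) hu
  have hu0 : 0 ≤ L / 2 ^ k := by positivity
  have hexp : Real.exp (L / 2 ^ k) - 1 ≤ 2 * L / 2 ^ k := by
    have h1 : |L / 2 ^ k| ≤ 1 := by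
      rw [abs_of_nonneg hu0]
      exact (div_le_one h2).mpr hLk
    have := (le_abs_self _).trans (Real.abs_exp_sub_one_le h1)
    rwa [abs_of_nonneg hu0, ← mul_div_assoc] at this
  have hexp0 : 0 ≤ Real.exp (L / 2 ^ k) - 1 := by
    have := Real.add_one_le_exp (L / 2 ^ k)
    linarith
  calc |logApprox m k x - Real.log x|
      = 2 ^ k * |Real.log (Real.sqrt^[k] x) - gaussLog m (Real.sqrt^[k] x)| := by
        have : logApprox m k x - Real.log x =
            -(2 ^ k * (Real.log (Real.sqrt^[k] x) - gaussLog m (Real.sqrt^[k] x))) := by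
          rw [logApprox, log_iterate_sqrt hx]
          field_simp
          ring
        rw [this, abs_neg, abs_mul, abs_of_pos h2]
    _ ≤ 2 ^ k * (|Real.log x| / 2 ^ k * (2 * L / 2 ^ k) ^ (2 * m)) := by
        rw [habs] at h
        refine mul_le_mul_of_nonneg_left (h.trans ?_) h2.le
        gcongr
    _ = |Real.log x| * (2 * L / 2 ^ k) ^ (2 * m) := by field_simp
    _ ≤ _ := by gcongr

section

/-! ### Traces and functional calculus of Hermitian matrices -/

open Matrix

variable {n : Type*} [Fintype n]

lemma trMul_sub (A B C : Matrix n n ℂ) : trMul (A - B) C = trMul A C - trMul B C := by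
  simp [trMul, sub_mul]

lemma trMul_smul (c : ℝ) (A C : Matrix n n ℂ) : trMul (c • A) C = c * trMul A C := by
  simp [trMul]

lemma trMul_sum {ι : Type*} (s : Finset ι) (A : ι → Matrix n n ℂ) (C : Matrix n n ℂ) :
    trMul (∑ i ∈ s, A i) C = ∑ i ∈ s, trMul (A i) C := by
  simp [trMul, Finset.sum_mul, trace_sum]

lemma trMul_comm (A B : Matrix n n ℂ) : trMul A B = trMul B A := by
  rw [trMul, trMul, trace_mul_comm]

variable [DecidableEq n]

lemma trMul_nonneg {A B : Matrix n n ℂ} (hA : A.PosSemidef) (hB : B.PosSemidef) :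
    0 ≤ trMul A B := by
  obtain ⟨S, rfl⟩ : ∃ S : Matrix n n ℂ, A = Sᴴ * S := by
    open scoped MatrixOrder in
    exact CStarAlgebra.nonneg_iff_eq_star_mul_self.mp hA.nonneg
  have h := (hB.mul_mul_conjTranspose_same S).trace_nonneg
  rw [trMul, mul_assoc, trace_mul_comm]
  exact (Complex.nonneg_iff.mp h).1

lemma trMul_le_of_posSemidef_sub {A B C : Matrix n n ℂ} (h : (B - A).PosSemidef)
    (hC : C.PosSemidef) : trMul A C ≤ trMul B C := by
  have := trMul_nonneg h hC
  rw [trMul_sub] at this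
  linarith

/-- The orthogonal projection onto the `i`-th eigenvector of a Hermitian matrix. -/
def eigenProj {A : Matrix n n ℂ} (hA : A.IsHermitian) (i : n) : Matrix n n ℂ :=
  (hA.eigenvectorUnitary : Matrix n n ℂ) * diagonal (Pi.single i 1) *
    (hA.eigenvectorUnitary : Matrix n n ℂ)ᴴ

lemma eigenProj_posSemidef {A : Matrix n n ℂ} (hA : A.IsHermitian) (i : n) :
    (eigenProj hA i).PosSemidef := by
  refine PosSemidef.mul_mul_conjTranspose_same (PosSemidef.diagonal fun j => ?_) _
  by_cases h : j = i
  · subst h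
    simp
  · simp [h]

lemma cfc_eq_sum_eigenProj {A : Matrix n n ℂ} (hA : A.IsHermitian) (f : ℝ → ℝ) :
    cfc f A = ∑ i, f (hA.eigenvalues i) • eigenProj hA i := by
  have hd : diagonal ((RCLike.ofReal : ℝ → ℂ) ∘ f ∘ hA.eigenvalues) =
      ∑ i, f (hA.eigenvalues i) • diagonal (Pi.single i (1 : ℂ)) := by
    ext a b
    simp [Matrix.sum_apply, diagonal_apply, Pi.single_apply]
  rw [hA.cfc_eq f, IsHermitian.cfc, Unitary.conjStarAlgAut_apply, hd, Finset.mul_sum,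
    Finset.sum_mul]
  simp [eigenProj, star_eq_conjTranspose]

lemma sum_eigenProj {A : Matrix n n ℂ} (hA : A.IsHermitian) : ∑ i, eigenProj hA i = 1 := by
  have h := cfc_eq_sum_eigenProj hA (fun _ => 1)
  have hA' : IsSelfAdjoint A := hA
  rw [cfc_const_one ℝ A] at h
  simpa using h.symm

lemma eq_sum_eigenProj {A : Matrix n n ℂ} (hA : A.IsHermitian) :
    A = ∑ i, hA.eigenvalues i • eigenProj hA i := by
  have hA' : IsSelfAdjoint A := hA
  rw [← cfc_eq_sum_eigenProj hA (fun x => x)]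
  exact (cfc_id' ℝ A).symm

/-- The projective measurement in an eigenbasis of a Hermitian matrix. -/
def eigenPOVM {A : Matrix n n ℂ} (hA : A.IsHermitian) : POVM n n where
  op := eigenProj hA
  posSemidef := eigenProj_posSemidef hA
  sum_eq_one := sum_eigenProj hA

lemma cfc_mul_of_matrix {A : Matrix n n ℂ} (f g : ℝ → ℝ) :
    cfc (fun x => f x * g x) A = cfc f A * cfc g A :=
  cfc_mul f g A (A.finite_real_spectrum.continuousOn f) (A.finite_real_spectrum.continuousOn g)

lemma cfc_posSemidef {A : Matrix n n ℂ} (hA : A.IsHermitian) {f : ℝ → ℝ}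
    (hf : ∀ i, 0 ≤ f (hA.eigenvalues i)) : (cfc f A).PosSemidef := by
  rw [cfc_eq_sum_eigenProj hA]
  exact posSemidef_sum _ fun i _ => (eigenProj_posSemidef hA i).smul (hf i)

lemma cfc_congr_eigenvalues {A : Matrix n n ℂ} (hA : A.IsHermitian) {f g : ℝ → ℝ}
    (h : ∀ i, f (hA.eigenvalues i) = g (hA.eigenvalues i)) : cfc f A = cfc g A := by
  simp [cfc_eq_sum_eigenProj hA, h]

lemma cfc_isHermitian (A : Matrix n n ℂ) (f : ℝ → ℝ) : (cfc f A).IsHermitian :=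
  cfc_predicate f A

/-- The order of the squares implies that of the matrices: on an eigenvector of `S - Z` with
eigenvalue `μ < 0`, the form of `S² - Z²` would be `2μ⟨v, Sv⟩ - μ²‖v‖² < 0`. -/
lemma posSemidef_sub_of_mul_self {S Z : Matrix n n ℂ} (hS : S.PosSemidef) (hZ : Z.IsHermitian)
    (h : (S * S - Z * Z).PosSemidef) : (S - Z).PosSemidef := by
  have hSZ : (S - Z).IsHermitian := hS.1.sub hZ
  rw [hSZ.posSemidef_iff_eigenvalues_nonneg]
  intro i
  by_contra hneg
  simp only [Pi.zero_apply, not_le] at hneg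
  set μ := hSZ.eigenvalues i
  set v : n → ℂ := (hSZ.eigenvectorBasis i).ofLp
  have hv : (S - Z) *ᵥ v = μ • v := hSZ.mulVec_eigenvectorBasis i
  have hv0 : v ≠ 0 := by
    have := hSZ.eigenvectorBasis.toBasis.ne_zero i
    intro h0
    apply this
    ext j
    simpa using congrFun h0 j
  have hZv : Z *ᵥ v = S *ᵥ v - μ • v := by
    rw [← hv, sub_mulVec]
    abel
  have h1 := h.dotProduct_mulVec_nonneg v
  have h2 := hS.dotProduct_mulVec_nonneg v
  have h3 : 0 < star v ⬝ᵥ v := dotProduct_star_self_pos_iff.mpr hv0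
  have h4 : star v ⬝ᵥ ((S * S - Z * Z) *ᵥ v) =
      2 * μ * (star v ⬝ᵥ (S *ᵥ v)) - μ ^ 2 * (star v ⬝ᵥ v) := by
    have e1 : star v ⬝ᵥ (Z *ᵥ (Z *ᵥ v)) = star (Z *ᵥ v) ⬝ᵥ (Z *ᵥ v) := by
      rw [star_mulVec, hZ.eq, dotProduct_mulVec]
    have e2 : star v ⬝ᵥ (S *ᵥ (S *ᵥ v)) = star (S *ᵥ v) ⬝ᵥ (S *ᵥ v) := by
      rw [star_mulVec, hS.1.eq, dotProduct_mulVec]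
    have e3 : star (S *ᵥ v) ⬝ᵥ v = star v ⬝ᵥ (S *ᵥ v) := by
      rw [star_mulVec, hS.1.eq, dotProduct_mulVec]
    rw [sub_mulVec, dotProduct_sub, ← mulVec_mulVec, ← mulVec_mulVec, e1, e2, hZv]
    simp only [star_sub, star_smul, sub_dotProduct, dotProduct_sub, smul_dotProduct,
      dotProduct_smul, e3, Complex.real_smul, star_trivial]
    ring
  rw [h4] at h1
  obtain ⟨a, ha⟩ : ∃ a : ℝ, star v ⬝ᵥ (S *ᵥ v) = a := ⟨_, (Complex.eq_re_of_ofReal_le h2)⟩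
  obtain ⟨b, hb⟩ : ∃ b : ℝ, star v ⬝ᵥ v = b := ⟨_, (Complex.eq_re_of_ofReal_le h3.le)⟩
  rw [ha] at h1 h2
  rw [hb] at h1 h3
  norm_cast at h1 h2 h3
  nlinarith [mul_pos (neg_pos.mpr hneg) (mul_pos (neg_pos.mpr hneg) h3),
    mul_nonneg (neg_nonneg.mpr hneg.le) h2]

/-- The Schur complement step for a block with lower right corner `1`. -/
lemma posSemidef_sub_mul_self_of_fromBlocks {A Z : Matrix n n ℂ} (hZ : Z.IsHermitian)
    (h : (fromBlocks A Z Z 1).PosSemidef) : (A - Z * Z).PosSemidef := by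
  have := h.conjTranspose_mul_mul_same (fromRows 1 (-Z))
  rw [conjTranspose_fromRows_eq_fromCols_conjTranspose, fromCols_mul_fromBlocks,
    fromCols_mul_fromRows] at this
  convert this using 1
  simp [hZ.eq, sub_eq_add_neg]

end

section

open Matrix

variable {n : Type*} [Fintype n] [DecidableEq n]

/-! ### Feasible points lie below the functional calculus -/

lemma Herm.isHermitian {n : Type*} (A : Herm n) : (A : Matrix n n ℂ).IsHermitian := A.2

/-- The equality and matrix inequality constraints of the program, unbundled. -/
lemma approxSDP_feasible_iff (ρ σ : Matrix n n ℂ) {m k : ℕ} (x : Vars n m k) :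
    (approxSDP ρ σ m k).Feasible x ↔
      (x.ω : Matrix n n ℂ).PosDef ∧ x.Z 0 = x.ω ∧
        ∑ j, gaussWeight m j • x.T j = ((2 : ℝ) ^ k)⁻¹ • x.θ ∧
        (∀ i, (sqrtBlock i x).PosSemidef) ∧ ∀ j, (nodeBlock j x).PosSemidef := by
  simp only [SemidefiniteProgram.Feasible, approxSDP, affineOf, AffineMap.coe_mk, Sum.forall,
    Sum.elim_inl, Sum.elim_inr, Prod.mk_eq_zero, sub_eq_zero, and_assoc]

lemma approxSDP_objective (ρ σ : Matrix n n ℂ) {m k : ℕ} (x : Vars n m k) :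
    (approxSDP ρ σ m k).objective x = trMul x.θ ρ - trMul x.ω σ + 1 := rfl

/-- Each square-root block forces `Zᵢ₊₁² ≤ Zᵢ`, so that `Zᵢ ≤ ω ^ (1 / 2ⁱ)` by monotonicity of the
square root. -/
lemma cfc_iterate_sqrt_sub_posSemidef {m k : ℕ} {x : Vars n m k}
    (hω : (x.ω : Matrix n n ℂ).PosDef) (h0 : x.Z 0 = x.ω)
    (hb : ∀ i, (sqrtBlock i x).PosSemidef) (i : ℕ) (hi : i < k + 1) :
    (cfc (Real.sqrt^[i]) (x.ω : Matrix n n ℂ) - x.Z ⟨i, hi⟩).PosSemidef := by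
  induction i with
  | zero =>
    have hω' : IsSelfAdjoint (x.ω : Matrix n n ℂ) := x.ω.2
    have : cfc (Real.sqrt^[0]) (x.ω : Matrix n n ℂ) = x.ω := cfc_id ℝ (x.ω : Matrix n n ℂ)
    rw [this, show (⟨0, hi⟩ : Fin (k + 1)) = 0 from rfl, h0, sub_self]
    exact PosSemidef.zero
  | succ i ih =>
    have hZ := Herm.isHermitian (x.Z ⟨i + 1, hi⟩)
    refine posSemidef_sub_of_mul_self (cfc_posSemidef hω.1 fun a => ?_) hZ ?_
    · exact (iterate_sqrt_pos (hω.eigenvalues_pos a) _).le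
    · have hsq : cfc (Real.sqrt^[i + 1]) (x.ω : Matrix n n ℂ) *
          cfc (Real.sqrt^[i + 1]) (x.ω : Matrix n n ℂ) =
          cfc (Real.sqrt^[i]) (x.ω : Matrix n n ℂ) := by
        rw [← cfc_mul_of_matrix]
        refine cfc_congr_eigenvalues hω.1 fun a => ?_
        simp only [Function.iterate_succ_apply']
        exact Real.mul_self_sqrt (iterate_sqrt_pos (hω.eigenvalues_pos a) _).le
      rw [hsq]
      have hblock := posSemidef_sub_mul_self_of_fromBlocks hZ (hb ⟨i, by omega⟩)
      have := (ih (by omega)).add hblock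
      convert this using 1
      simp

/-- The block of a node `t` bounds `T` by `(W - 1)(1 + t (W - 1))⁻¹` for every positive `W ≥ Z`. It
suffices to evaluate the form of the block on the minimizing second component of the vector. -/
lemma cfc_logIntegrand_sub_posSemidef {A Z T : Matrix n n ℂ} (hA : A.IsHermitian) {r : ℝ → ℝ}
    (hr : ∀ i, 0 < r (hA.eigenvalues i)) (hZ : (cfc r A - Z).PosSemidef)
    {t : ℝ} (ht : t ∈ Set.Icc (0 : ℝ) 1)
    (h : (fromBlocks (Z - 1 - T) (-(√t • T)) (-(√t • T)) (1 - t • T)).PosSemidef) :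
    (cfc (fun y => logIntegrand t (r y)) A - T).PosSemidef := by
  set Y := cfc (fun y => 1 / (1 + t * (r y - 1))) A with hY
  set B := cfc (fun y => √t * (r y - 1) / (1 + t * (r y - 1))) A with hB
  have hA' : IsSelfAdjoint A := hA
  have hYH : Yᴴ = Y := cfc_isHermitian A _
  have hBH : Bᴴ = B := cfc_isHermitian A _
  have hpos : ∀ i, 1 + t * (r (hA.eigenvalues i) - 1) ≠ 0 := fun i =>
    (one_add_mul_sub_one_pos ht (hr i)).ne'
  have hsqrt : √t * √t = t := Real.mul_self_sqrt ht.1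
  have hYB : Y + √t • B = 1 := by
    rw [hB, hY, cfc_eq_sum_eigenProj hA, cfc_eq_sum_eigenProj hA, Finset.smul_sum,
      ← Finset.sum_add_distrib, ← sum_eigenProj hA]
    refine Finset.sum_congr rfl fun i _ => ?_
    rw [smul_smul, ← add_smul]
    have : 1 / (1 + t * (r (hA.eigenvalues i) - 1)) +
        √t * (√t * (r (hA.eigenvalues i) - 1) / (1 + t * (r (hA.eigenvalues i) - 1))) = 1 := by
      rw [← mul_div_assoc, ← mul_assoc, hsqrt, ← add_div]
      exact div_self (hpos i)
    rw [this, one_smul]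
  have hsum : Y * (cfc r A - 1) * Y + B * B = cfc (fun y => logIntegrand t (r y)) A := by
    rw [← cfc_const_one ℝ A, ← cfc_sub r (fun _ => (1 : ℝ)) A
      (A.finite_real_spectrum.continuousOn _) (A.finite_real_spectrum.continuousOn _), hY, hB,
      ← cfc_mul_of_matrix, ← cfc_mul_of_matrix, ← cfc_mul_of_matrix,
      ← cfc_add (a := A) _ _ (A.finite_real_spectrum.continuousOn _)
      (A.finite_real_spectrum.continuousOn _)]
    refine cfc_congr_eigenvalues hA fun i => ?_
    have := hpos i
    rw [logIntegrand]
    generalize r (hA.eigenvalues i) = w at *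
    generalize hD : 1 + t * (w - 1) = D at *
    have h1 : √t * (w - 1) / D * (√t * (w - 1) / D) = t * (w - 1) ^ 2 / D ^ 2 := by
      rw [div_mul_div_comm, mul_mul_mul_comm, hsqrt]
      ring
    rw [h1]
    field_simp
    rw [← hD]
    ring
  have hconj := h.conjTranspose_mul_mul_same (fromRows Y B)
  rw [conjTranspose_fromRows_eq_fromCols_conjTranspose, fromCols_mul_fromBlocks,
    fromCols_mul_fromRows, hYH, hBH] at hconj
  have hconj' := hZ.conjTranspose_mul_mul_same Y
  rw [hYH] at hconj'
  convert hconj.add hconj' using 1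
  have hT : T = (Y + √t • B) * T * (Y + √t • B) := by rw [hYB, one_mul, mul_one]
  rw [← hsum]
  nth_rewrite 1 [hT]
  rw [← hsqrt]
  simp only [mul_sub, sub_mul, mul_add, add_mul, mul_neg, neg_mul, smul_mul_assoc, mul_smul_comm,
    mul_one, smul_smul, hsqrt, smul_add, mul_assoc]
  abel

lemma trMul_theta_le {ρ σ : Matrix n n ℂ} (hρ : ρ.PosSemidef) {m k : ℕ} {x : Vars n m k}
    (hx : (approxSDP ρ σ m k).Feasible x) :
    trMul x.θ ρ ≤ ∑ i, logApprox m k ((Herm.isHermitian x.ω).eigenvalues i) *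
      trMul (eigenProj (Herm.isHermitian x.ω) i) ρ := by
  rw [approxSDP_feasible_iff] at hx
  obtain ⟨hω, h0, hθ, hs, hn⟩ := hx
  have hT : ∀ j, trMul (x.T j) ρ ≤
      ∑ i, logIntegrand (gaussNode m j) (Real.sqrt^[k] ((Herm.isHermitian x.ω).eigenvalues i)) *
        trMul (eigenProj (Herm.isHermitian x.ω) i) ρ := by
    intro j
    have h := trMul_le_of_posSemidef_sub (cfc_logIntegrand_sub_posSemidef (Herm.isHermitian x.ω)
      (fun i => iterate_sqrt_pos (hω.eigenvalues_pos i) k)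
      (cfc_iterate_sqrt_sub_posSemidef hω h0 hs k (Nat.lt_succ_self k))
      (gaussNode_mem_Icc j) (hn j)) hρ
    rw [cfc_eq_sum_eigenProj (Herm.isHermitian x.ω), trMul_sum] at h
    simpa only [trMul_smul] using h
  have hθ' : trMul x.θ ρ = 2 ^ k * ∑ j, gaussWeight m j * trMul (x.T j) ρ := by
    have h := congrArg (fun A : Herm n => trMul (A : Matrix n n ℂ) ρ) hθ
    simp only [AddSubgroup.val_finsetSum, selfAdjoint.val_smul, trMul_sum, trMul_smul] at h
    rw [h]
    field_simp
  rw [hθ']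
  calc 2 ^ k * ∑ j, gaussWeight m j * trMul (x.T j) ρ
      ≤ 2 ^ k * ∑ j, gaussWeight m j * ∑ i, logIntegrand (gaussNode m j)
          (Real.sqrt^[k] ((Herm.isHermitian x.ω).eigenvalues i)) *
            trMul (eigenProj (Herm.isHermitian x.ω) i) ρ :=
        mul_le_mul_of_nonneg_left (Finset.sum_le_sum fun j _ =>
          mul_le_mul_of_nonneg_left (hT j) (gaussWeight_nonneg j)) (by positivity)
    _ = _ := by
        simp only [logApprox, gaussLog, Finset.mul_sum, Finset.sum_mul]
        rw [Finset.sum_comm]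
        refine Finset.sum_congr rfl fun i _ => Finset.sum_congr rfl fun j _ => ?_
        ring

/-! ### Feasible points from measurements -/

namespace POVM

variable {X : Type*} [Fintype X] (Λ : POVM n X)

/-- The observable `∑ₓ c(x) Λₓ`. -/
def comb (c : X → ℝ) : Herm n :=
  ⟨∑ x, c x • Λ.op x, isSelfAdjoint_sum _ fun x _ =>
    (IsSelfAdjoint.all (c x)).smul (Λ.posSemidef x).1⟩

lemma coe_comb (c : X → ℝ) : (Λ.comb c : Matrix n n ℂ) = ∑ x, c x • Λ.op x := rfl

lemma comb_one : (Λ.comb 1 : Matrix n n ℂ) = 1 := by simp [coe_comb, Λ.sum_eq_one]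

lemma comb_sub (c d : X → ℝ) : (Λ.comb (c - d) : Matrix n n ℂ) = Λ.comb c - Λ.comb d := by
  simp [coe_comb, sub_smul]

lemma comb_smul (a : ℝ) (c : X → ℝ) : (Λ.comb (a • c) : Matrix n n ℂ) = a • Λ.comb c := by
  simp [coe_comb, Finset.smul_sum, smul_smul]

lemma trMul_comb (c : X → ℝ) (ρ : Matrix n n ℂ) :
    trMul (Λ.comb c) ρ = ∑ x, c x * trMul (Λ.op x) ρ := by
  rw [coe_comb, trMul_sum]
  simp only [trMul_smul]

lemma comb_posDef {c : X → ℝ} {δ : ℝ} (hδ : 0 < δ) (hc : ∀ x, δ ≤ c x) :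
    (Λ.comb c : Matrix n n ℂ).PosDef := by
  have h1 : (Λ.comb c : Matrix n n ℂ) = δ • (1 : Matrix n n ℂ) + ∑ x, (c x - δ) • Λ.op x := by
    simp [coe_comb, sub_smul, ← Finset.smul_sum, Λ.sum_eq_one]
  rw [h1]
  exact (PosDef.one.smul hδ).add_posSemidef
    (posSemidef_sum _ fun x _ => (Λ.posSemidef x).smul (sub_nonneg.mpr (hc x)))

/-- Blocks whose coefficients are rank-one positive `2 × 2` matrices are positive. -/
lemma fromBlocks_comb_posSemidef (a b : X → ℝ) :
    (fromBlocks (Λ.comb (a * a) : Matrix n n ℂ) (Λ.comb (a * b) : Matrix n n ℂ)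
      (Λ.comb (a * b) : Matrix n n ℂ) (Λ.comb (b * b) : Matrix n n ℂ)).PosSemidef := by
  have h : fromBlocks (Λ.comb (a * a) : Matrix n n ℂ) (Λ.comb (a * b) : Matrix n n ℂ)
      (Λ.comb (a * b) : Matrix n n ℂ) (Λ.comb (b * b) : Matrix n n ℂ) =
      ∑ x, (fromCols (a x • (1 : Matrix n n ℂ)) (b x • 1))ᴴ * Λ.op x *
        fromCols (a x • (1 : Matrix n n ℂ)) (b x • 1) := by
    have hx : ∀ x, (fromCols (a x • (1 : Matrix n n ℂ)) (b x • 1))ᴴ * Λ.op x *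
        fromCols (a x • (1 : Matrix n n ℂ)) (b x • 1) =
        fromBlocks ((a x * a x) • Λ.op x) ((a x * b x) • Λ.op x) ((a x * b x) • Λ.op x)
          ((b x * b x) • Λ.op x) := by
      intro x
      rw [conjTranspose_fromCols_eq_fromRows_conjTranspose, fromRows_mul, fromRows_mul_fromCols]
      simp [smul_smul, mul_comm]
    simp only [hx]
    ext (i | i) (j | j) <;> simp [coe_comb, Matrix.sum_apply]
  rw [h]
  exact posSemidef_sum _ fun x _ => (Λ.posSemidef x).conjTranspose_mul_mul_same _

/-- The point of the program obtained from a measurement and positive numbers `l(x)`: every variable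
is the combination of the measurement operators by the optimal scalars for `l(x)`. -/
def vars (m k : ℕ) (l : X → ℝ) : Vars n m k :=
  (Λ.comb l, Λ.comb fun x => logApprox m k (l x),
    fun j => Λ.comb fun x => logIntegrand (gaussNode m j) (Real.sqrt^[k] (l x)),
    fun i => Λ.comb fun x => Real.sqrt^[i] (l x))

/-- All the matrix inequalities reduce to scalar ones, since the blocks are combinations of the
measurement operators with positive `2 × 2` coefficients. -/
lemma vars_feasible (ρ σ : Matrix n n ℂ) (m k : ℕ) {l : X → ℝ} {δ : ℝ} (hδ : 0 < δ)
    (hl : ∀ x, δ ≤ l x) : (approxSDP ρ σ m k).Feasible (Λ.vars m k l) := by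
  have hl0 : ∀ x, 0 < l x := fun x => hδ.trans_le (hl x)
  rw [approxSDP_feasible_iff]
  refine ⟨Λ.comb_posDef hδ hl, rfl, ?_, fun i => ?_, fun j => ?_⟩
  · apply Subtype.ext
    simp only [Vars.T, Vars.θ, vars, AddSubgroup.val_finsetSum, selfAdjoint.val_smul, coe_comb,
      Finset.smul_sum, smul_smul]
    rw [Finset.sum_comm]
    refine Finset.sum_congr rfl fun x _ => ?_
    rw [← Finset.sum_smul, logApprox, gaussLog]
    congr 1
    field_simp
  · have h := Λ.fromBlocks_comb_posSemidef (fun x => Real.sqrt^[i + 1] (l x)) 1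
    convert h using 1
    rw [mul_one, mul_one, comb_one]
    have : ((fun x => Real.sqrt^[i + 1] (l x)) * fun x => Real.sqrt^[i + 1] (l x)) =
        fun x => Real.sqrt^[i] (l x) := by
      ext x
      simp only [Pi.mul_apply, Function.iterate_succ_apply']
      exact Real.mul_self_sqrt (iterate_sqrt_pos (hl0 x) _).le
    rw [this]
    rfl
  · set t := gaussNode m j
    set w : X → ℝ := fun x => Real.sqrt^[k] (l x)
    have hpos : ∀ x, 0 < 1 + t * (w x - 1) := fun x =>
      one_add_mul_sub_one_pos (gaussNode_mem_Icc j) (iterate_sqrt_pos (hl0 x) k)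
    have ht0 : 0 ≤ t := (gaussNode_mem_Icc j).1
    set a : X → ℝ := fun x => √t * (w x - 1) / √(1 + t * (w x - 1))
    set b : X → ℝ := fun x => -1 / √(1 + t * (w x - 1))
    set τ : X → ℝ := fun x => logIntegrand t (w x)
    have haa : a * a = w - 1 - τ := by
      ext x
      have := (hpos x).ne'
      simp only [a, τ, Pi.mul_apply, Pi.sub_apply, Pi.one_apply, logIntegrand]
      rw [div_mul_div_comm, Real.mul_self_sqrt (hpos x).le, mul_mul_mul_comm,
        Real.mul_self_sqrt ht0]
      generalize hD : 1 + t * (w x - 1) = D at *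
      field_simp
      rw [← hD]
      ring
    have hab : a * b = -√t • τ := by
      ext x
      simp only [a, b, τ, Pi.mul_apply, Pi.smul_apply, smul_eq_mul, logIntegrand]
      rw [div_mul_div_comm, Real.mul_self_sqrt (hpos x).le]
      ring
    have hbb : b * b = 1 - t • τ := by
      ext x
      have := (hpos x).ne'
      simp only [b, τ, Pi.mul_apply, Pi.sub_apply, Pi.one_apply, Pi.smul_apply, smul_eq_mul,
        logIntegrand]
      rw [div_mul_div_comm, Real.mul_self_sqrt (hpos x).le]
      field_simp
      ring
    have h := Λ.fromBlocks_comb_posSemidef a b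
    rw [haa, hab, hbb, comb_sub, comb_sub, comb_sub, comb_smul, comb_smul, comb_one, neg_smul] at h
    exact h

lemma objective_vars (ρ σ : Matrix n n ℂ) (m k : ℕ) (l : X → ℝ) :
    (approxSDP ρ σ m k).objective (Λ.vars m k l) =
      ∑ x, logApprox m k (l x) * trMul (Λ.op x) ρ - ∑ x, l x * trMul (Λ.op x) σ + 1 := by
  rw [approxSDP_objective]
  simp only [Vars.θ, Vars.ω, vars, trMul_comb]

end POVM

end

section

open Matrix

/-! ### Classical relative entropy -/

section Classical

variable {X Y : Type*} [Fintype X] [Fintype Y]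

lemma relEnt_of_support {p q : X → ℝ} (h : ∀ x, q x = 0 → p x = 0) :
    relEnt p q = ((∑ x, p x * Real.log (p x / q x) : ℝ) : EReal) :=
  if_pos fun x hx hq => hx (h x hq)

lemma relEnt_ne_bot (p q : X → ℝ) : relEnt p q ≠ ⊥ := by
  unfold relEnt
  split_ifs
  · exact EReal.coe_ne_bot _
  · exact top_ne_bot

lemma relEnt_comp_equiv (e : Y ≃ X) (p q : X → ℝ) :
    relEnt (fun y => p (e y)) (fun y => q (e y)) = relEnt p q := by
  have h : (Function.support (fun y => p (e y)) ⊆ Function.support fun y => q (e y)) ↔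
      Function.support p ⊆ Function.support q :=
    ⟨fun h x hx => by
      have := h (show e.symm x ∈ _ by simpa using hx)
      simpa using this, fun h y hy => h hy⟩
  simp only [relEnt, e.sum_comp fun x => p x * Real.log (p x / q x)]
  classical exact if_congr h rfl rfl

/-- The variational lower bound, from `ln z ≤ z - 1` with `z = l q / p`. -/
lemma variational_le_relEnt {p q l : X → ℝ} (hp : ∀ x, 0 ≤ p x) (hq : ∀ x, 0 ≤ q x)
    (hp1 : ∑ x, p x = 1) (hl : ∀ x, 0 < l x) :
    ((∑ x, Real.log (l x) * p x - ∑ x, l x * q x + 1 : ℝ) : EReal) ≤ relEnt p q := by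
  by_cases h : ∀ x, q x = 0 → p x = 0
  · rw [relEnt_of_support h, EReal.coe_le_coe_iff, ← hp1, ← Finset.sum_sub_distrib,
      ← Finset.sum_add_distrib]
    refine Finset.sum_le_sum fun x _ => ?_
    rcases (hp x).eq_or_lt with h0 | hpos
    · rw [← h0]
      have := mul_nonneg (hl x).le (hq x)
      simp only [mul_zero, zero_div, zero_mul]
      linarith
    · have hqx : 0 < q x := lt_of_le_of_ne (hq x) fun h0 => hpos.ne' (h x h0.symm)
      have h1 := Real.log_le_sub_one_of_pos (div_pos (mul_pos (hl x) hqx) hpos)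
      rw [Real.log_div (mul_pos (hl x) hqx).ne' hpos.ne',
        Real.log_mul (hl x).ne' hqx.ne'] at h1
      rw [Real.log_div hpos.ne' hqx.ne']
      have h2 := mul_le_mul_of_nonneg_left h1 hpos.le
      rw [mul_sub (p x) (l x * q x / p x), mul_div_cancel₀ _ hpos.ne'] at h2
      linarith
  · have : relEnt p q = ⊤ := if_neg fun hs => h fun x hx => by
      by_contra hpx
      exact hs hpx hx
    rw [this]
    exact le_top

/-- Truncating the optimal choice `l = p / q` of the variational formula from below at `δ` costs at
most `δ ∑ q`. Here `p / q = 0` where `p = q = 0`. -/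
lemma sum_mul_log_div_le {p q : X → ℝ} (hp : ∀ x, 0 ≤ p x) (hq : ∀ x, 0 ≤ q x)
    (hp1 : ∑ x, p x = 1) (h : ∀ x, q x = 0 → p x = 0) {δ : ℝ} (hδ : 0 < δ) :
    ∑ x, p x * Real.log (p x / q x) - δ * ∑ x, q x ≤
      ∑ x, Real.log (max (p x / q x) δ) * p x - ∑ x, max (p x / q x) δ * q x + 1 := by
  have h1 : ∑ x, p x * Real.log (p x / q x) ≤ ∑ x, Real.log (max (p x / q x) δ) * p x := by
    refine Finset.sum_le_sum fun x _ => ?_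
    rcases (hp x).eq_or_lt with h0 | hpos
    · simp [← h0]
    · have hqx : 0 < q x := lt_of_le_of_ne (hq x) fun h0 => hpos.ne' (h x h0.symm)
      rw [mul_comm]
      exact mul_le_mul_of_nonneg_right
        (Real.log_le_log (div_pos hpos hqx) (le_max_left _ _)) hpos.le
  have h2 : ∑ x, max (p x / q x) δ * q x ≤ 1 + δ * ∑ x, q x := by
    rw [← hp1, Finset.mul_sum, ← Finset.sum_add_distrib]
    refine Finset.sum_le_sum fun x _ => ?_
    rcases (hq x).eq_or_lt with h0 | hpos
    · simp [← h0, h x h0.symm]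
    · have : max (p x / q x) δ ≤ p x / q x + δ :=
        max_le (by linarith) (by linarith [div_nonneg (hp x) (hq x)])
      calc max (p x / q x) δ * q x ≤ (p x / q x + δ) * q x :=
            mul_le_mul_of_nonneg_right this hpos.le
        _ = p x + δ * q x := by field_simp
  linarith

end Classical

variable {n : Type*} [Fintype n] [DecidableEq n]

/-! ### The variational formula -/

namespace POVM

variable {X : Type*} [Fintype X] (Λ : POVM n X)

lemma trMul_op_nonneg {ρ : Matrix n n ℂ} (hρ : ρ.PosSemidef) (x : X) : 0 ≤ trMul (Λ.op x) ρ :=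
  trMul_nonneg (Λ.posSemidef x) hρ

lemma sum_trMul_op (ρ : Matrix n n ℂ) : ∑ x, trMul (Λ.op x) ρ = ρ.trace.re := by
  rw [← trMul_sum, Λ.sum_eq_one, trMul, one_mul]

lemma sum_trMul_op_state {ρ : Matrix n n ℂ} (hρ : IsState ρ) : ∑ x, trMul (Λ.op x) ρ = 1 := by
  rw [sum_trMul_op, hρ.2, Complex.one_re]

lemma relEnt_le_measuredRelEnt (ρ σ : Matrix n n ℂ) :
    relEnt (fun x => trMul (Λ.op x) ρ) (fun x => trMul (Λ.op x) σ) ≤ measuredRelEnt ρ σ := by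
  have e := (Fintype.equivFin X).symm
  let Λ' : POVM n (Fin (Fintype.card X)) :=
    ⟨fun i => Λ.op (e i), fun i => Λ.posSemidef _, by rw [e.sum_comp, Λ.sum_eq_one]⟩
  rw [← relEnt_comp_equiv e]
  exact le_iSup₂ (f := fun (N : ℕ) (Λ : POVM n (Fin N)) =>
    relEnt (fun x => trMul (Λ.op x) ρ) (fun x => trMul (Λ.op x) σ)) _ Λ'

end POVM

lemma trMul_eq_sum_eigenvalues {A : Matrix n n ℂ} (hA : A.IsHermitian) (ρ : Matrix n n ℂ) :
    trMul A ρ = ∑ i, hA.eigenvalues i * trMul (eigenProj hA i) ρ := by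
  conv_lhs => rw [eq_sum_eigenProj hA, trMul_sum]
  simp only [trMul_smul]

lemma trMul_cfc {A : Matrix n n ℂ} (hA : A.IsHermitian) (f : ℝ → ℝ) (ρ : Matrix n n ℂ) :
    trMul (cfc f A) ρ = ∑ i, f (hA.eigenvalues i) * trMul (eigenProj hA i) ρ := by
  rw [cfc_eq_sum_eigenProj hA, trMul_sum]
  simp only [trMul_smul]

/-- The variational functional with weights `l` is at most the relative entropy of the outcomes of
the measurement in an eigenbasis of `ω`. -/
lemma variational_le_measuredRelEnt {ρ σ ω : Matrix n n ℂ} (hρ : IsState ρ) (hσ : σ.PosSemidef)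
    (hω : ω.IsHermitian) {l : n → ℝ} (hl : ∀ i, 0 < l i) :
    ((∑ i, Real.log (l i) * trMul (eigenProj hω i) ρ -
      ∑ i, l i * trMul (eigenProj hω i) σ + 1 : ℝ) : EReal) ≤ measuredRelEnt ρ σ :=
  (variational_le_relEnt (fun i => (eigenPOVM hω).trMul_op_nonneg hρ.1 i)
    (fun i => (eigenPOVM hω).trMul_op_nonneg hσ i) ((eigenPOVM hω).sum_trMul_op_state hρ) hl).trans
    ((eigenPOVM hω).relEnt_le_measuredRelEnt ρ σ)

lemma tendsto_logApprox {y : ℝ} (hy : 0 < y) :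
    Tendsto (fun N : ℕ => logApprox N N y) atTop (𝓝 (Real.log y)) := by
  set L := |Real.log y|
  have hpow : Tendsto (fun N : ℕ => (2 : ℝ) ^ N) atTop atTop :=
    tendsto_pow_atTop_atTop_of_one_lt one_lt_two
  have hlim : Tendsto (fun N : ℕ => L * (2 * L / 2 ^ N)) atTop (𝓝 0) := by
    simpa using (hpow.const_div_atTop (2 * L)).const_mul L
  rw [tendsto_iff_dist_tendsto_zero]
  refine squeeze_zero' (.of_forall fun _ => dist_nonneg) ?_ hlim
  filter_upwards [hpow.eventually_ge_atTop (2 * L), eventually_ge_atTop 1] with N hN hN1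
  have hL : 0 ≤ L := abs_nonneg _
  rw [Real.dist_eq]
  refine (abs_logApprox_sub_log_le N N hy le_rfl (by linarith)).trans ?_
  refine mul_le_mul_of_nonneg_left ?_ hL
  exact pow_le_of_le_one (by positivity) ((div_le_one (by positivity)).mpr hN) (by omega)

/-- The operator Jensen inequality `∑ₓ ln(l(x)) Λₓ ≤ ln(∑ₓ l(x) Λₓ)`, traced against `ρ`. It is the
limit of the corresponding inequality for the rational approximations, which holds because the
point of the program obtained from the measurement is feasible. -/
lemma POVM.sum_log_mul_le_trMul_cfc_log {X : Type*} [Fintype X] (Λ : POVM n X)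
    {ρ : Matrix n n ℂ} (hρ : ρ.PosSemidef) {l : X → ℝ} {δ : ℝ} (hδ : 0 < δ) (hl : ∀ x, δ ≤ l x) :
    ∑ x, Real.log (l x) * trMul (Λ.op x) ρ ≤
      trMul (cfc Real.log (Λ.comb l : Matrix n n ℂ)) ρ := by
  rw [trMul_cfc (Herm.isHermitian (Λ.comb l))]
  refine le_of_tendsto_of_tendsto'
    (tendsto_finsetSum _ fun x _ => (tendsto_logApprox (hδ.trans_le (hl x))).mul_const _)
    (tendsto_finsetSum _ fun i _ =>
      (tendsto_logApprox ((Λ.comb_posDef hδ hl).eigenvalues_pos i)).mul_const _) fun N => ?_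
  have h := trMul_theta_le hρ (Λ.vars_feasible ρ 0 N N hδ hl)
  simpa only [Vars.θ, Vars.ω, vars, trMul_comb] using h

lemma connection_one (f : ℝ → ℝ) (A : Matrix n n ℂ) : connection f 1 A = cfc f A := by
  have h : cfc Real.sqrt (1 : Matrix n n ℂ) = 1 := by
    rw [cfc_apply_one]
    simp
  rw [connection, h]
  simp

lemma coe_le_of_forall_coe_sub_le {r : ℝ} {a : EReal} (h : ∀ ε > 0, ((r - ε : ℝ) : EReal) ≤ a) :
    (r : EReal) ≤ a := by
  refine EReal.le_of_forall_lt_iff_le.mp fun z hz => ?_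
  by_contra! hzr
  have h' := h (r - z) (sub_pos.mpr (EReal.coe_lt_coe_iff.mp hzr))
  rw [sub_sub_cancel] at h'
  exact hz.not_ge h'

/-- The set of values of the variational formula. -/
def variationalValues (ρ σ : Matrix n n ℂ) : Set EReal :=
  {v : EReal | ∃ ω θ : Matrix n n ℂ, ω.PosDef ∧ θ.IsHermitian ∧
    (connection Real.log 1 ω - θ).PosSemidef ∧
    v = ((trMul θ ρ - trMul ω σ + 1 : ℝ) : EReal)}

lemma POVM.variational_le_sSup {X : Type*} [Fintype X] (Λ : POVM n X) {ρ : Matrix n n ℂ}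
    (hρ : ρ.PosSemidef) (σ : Matrix n n ℂ) {l : X → ℝ} {δ : ℝ} (hδ : 0 < δ)
    (hl : ∀ x, δ ≤ l x) :
    ((∑ x, Real.log (l x) * trMul (Λ.op x) ρ - ∑ x, l x * trMul (Λ.op x) σ + 1 : ℝ) : EReal) ≤
      sSup (variationalValues ρ σ) := by
  refine le_trans ?_ (le_sSup ⟨Λ.comb l, cfc Real.log (Λ.comb l : Matrix n n ℂ),
    Λ.comb_posDef hδ hl, cfc_isHermitian _ _, ?_, rfl⟩)
  · rw [EReal.coe_le_coe_iff, Λ.trMul_comb]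
    have := Λ.sum_log_mul_le_trMul_cfc_log hρ hδ hl
    linarith
  · rw [connection_one, sub_self]
    exact PosSemidef.zero

theorem measuredRelEnt_eq_sSup {ρ σ : Matrix n n ℂ} (hρ : IsState ρ) (hσ : σ.PosSemidef) :
    measuredRelEnt ρ σ = sSup (variationalValues ρ σ) := by
  refine le_antisymm (iSup₂_le fun N Λ => ?_) (sSup_le ?_)
  · have hp := Λ.trMul_op_nonneg hρ.1
    have hq := Λ.trMul_op_nonneg hσ
    have hp1 := Λ.sum_trMul_op_state hρ
    by_cases h : ∀ x, trMul (Λ.op x) σ = 0 → trMul (Λ.op x) ρ = 0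
    · rw [relEnt_of_support h]
      refine coe_le_of_forall_coe_sub_le fun ε hε => ?_
      have hs : 0 ≤ ∑ x, trMul (Λ.op x) σ := Finset.sum_nonneg fun x _ => hq x
      have hδ : 0 < ε / (1 + ∑ x, trMul (Λ.op x) σ) := by positivity
      refine le_trans ?_ (Λ.variational_le_sSup hρ.1 σ hδ fun x => le_max_right
        (trMul (Λ.op x) ρ / trMul (Λ.op x) σ) _)
      rw [EReal.coe_le_coe_iff]
      refine le_trans ?_ (sum_mul_log_div_le hp hq hp1 h hδ)
      have : ε / (1 + ∑ x, trMul (Λ.op x) σ) * ∑ x, trMul (Λ.op x) σ ≤ ε := by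
        rw [div_mul_eq_mul_div, div_le_iff₀ (by positivity)]
        nlinarith
      linarith
    · -- An outcome that has probability zero only under `σ` may be given any weight `exp c`.
      push Not at h
      obtain ⟨x₀, hq0, hp0⟩ := h
      have hp0' : 0 < trMul (Λ.op x₀) ρ := lt_of_le_of_ne (hp x₀) hp0.symm
      refine le_top.trans (top_le_iff.mpr (EReal.eq_top_iff_forall_lt _ |>.mpr fun b => ?_))
      set c : ℝ := (b + ∑ x, trMul (Λ.op x) σ) / trMul (Λ.op x₀) ρ with hc
      set l : Fin N → ℝ := Function.update 1 x₀ (Real.exp c) with hl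
      have hle : ∀ x, min 1 (Real.exp c) ≤ l x := by
        intro x
        by_cases hx : x = x₀
        · subst hx
          simp [hl]
        · simp [hl, hx]
      have h := Λ.variational_le_sSup hρ.1 σ (lt_min one_pos (Real.exp_pos c)) hle
      refine lt_of_lt_of_le ?_ h
      rw [EReal.coe_lt_coe_iff]
      have h1 : ∑ x, Real.log (l x) * trMul (Λ.op x) ρ = c * trMul (Λ.op x₀) ρ := by
        rw [Finset.sum_eq_single x₀]
        · simp [hl]
        · intro x _ hx
          simp [hl, hx]
        · simp
      have h2 : ∑ x, l x * trMul (Λ.op x) σ = ∑ x, trMul (Λ.op x) σ := by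
        refine Finset.sum_congr rfl fun x _ => ?_
        by_cases hx : x = x₀
        · rw [hx, hq0, mul_zero]
        · simp [hl, hx]
      rw [h1, h2, hc, div_mul_cancel₀ _ hp0]
      linarith
  · rintro v ⟨ω, θ, hω, -, hθ, rfl⟩
    rw [connection_one] at hθ
    have h := trMul_le_of_posSemidef_sub hθ hρ.1
    rw [trMul_cfc hω.1] at h
    refine le_trans ?_ (variational_le_measuredRelEnt hρ hσ hω.1 hω.eigenvalues_pos)
    rw [EReal.coe_le_coe_iff, trMul_eq_sum_eigenvalues hω.1 σ]
    linarith

end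

section

open Matrix

variable {n : Type*} [Fintype n] [DecidableEq n]

/-! ### Error of the semidefinite program -/

lemma exists_smul_one_sub_posSemidef {A : Matrix n n ℂ} (hA : A.IsHermitian) :
    ∃ c : ℝ, (c • (1 : Matrix n n ℂ) - A).PosSemidef := by
  have h : (∑ i, |hA.eigenvalues i|) • (1 : Matrix n n ℂ) - A =
      ∑ i, ((∑ i, |hA.eigenvalues i|) - hA.eigenvalues i) • eigenProj hA i := by
    simp only [sub_smul, Finset.sum_sub_distrib]
    rw [← Finset.smul_sum, sum_eigenProj, ← eq_sum_eigenProj hA]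
  refine ⟨∑ i, |hA.eigenvalues i|, h ▸ posSemidef_sum _ fun i _ => ?_⟩
  refine (eigenProj_posSemidef hA i).smul (sub_nonneg.mpr ((le_abs_self _).trans ?_))
  exact Finset.single_le_sum (f := fun i => |hA.eigenvalues i|) (fun _ _ => abs_nonneg _)
    (Finset.mem_univ i)

/-- If the support of `ρ` lies in that of `σ`, then `ρ = S (K ρ K) S` with `S = σ ^ (1/2)` and
`K` its pseudoinverse, so that `ρ ≤ C σ` as soon as `K ρ K ≤ C`. -/
lemma exists_smul_sub_posSemidef_of_support_le {ρ σ : Matrix n n ℂ} (hρ : ρ.PosSemidef)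
    (hσ : σ.PosSemidef) (h : support ρ ≤ support σ) :
    ∃ C : ℝ, 1 ≤ C ∧ (C • σ - ρ).PosSemidef := by
  have hσ' : IsSelfAdjoint σ := hσ.1
  set S := cfc Real.sqrt σ
  -- Here `1 / √0 = 0`, so that `K` vanishes on the kernel of `σ`.
  set K := cfc (fun x => 1 / √x) σ
  have hSH : Sᴴ = S := cfc_isHermitian σ _
  have hKH : Kᴴ = K := cfc_isHermitian σ _
  have hSS : S * S = σ := by
    conv_rhs => rw [← cfc_id' ℝ σ]
    rw [← cfc_mul_of_matrix]
    exact cfc_congr_eigenvalues hσ.1 fun i => Real.mul_self_sqrt (hσ.eigenvalues_nonneg i)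
  have hSKS : S * K * S = S := by
    rw [← cfc_mul_of_matrix, ← cfc_mul_of_matrix]
    refine cfc_congr_eigenvalues hσ.1 fun i => ?_
    by_cases h0 : √(hσ.1.eigenvalues i) = 0
    · simp [h0]
    · field_simp
  have hSK : S * K = K * S := by
    rw [← cfc_mul_of_matrix, ← cfc_mul_of_matrix]
    simp only [mul_comm]
  have hSKρ : S * K * ρ = ρ := by
    refine Matrix.mulVec_injective (funext fun v => ?_)
    obtain ⟨w, hw⟩ : ρ *ᵥ v ∈ support σ := h ⟨v, rfl⟩
    rw [mulVecLin_apply] at hw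
    rw [← mulVec_mulVec, ← hw, mulVec_mulVec, ← hSS, ← mul_assoc, hSKS]
  have hρKS : ρ * (K * S) = ρ := by
    have := congrArg conjTranspose hSKρ
    rwa [conjTranspose_mul, conjTranspose_mul, hSH, hKH, hρ.1.eq] at this
  obtain ⟨c, hc⟩ := exists_smul_one_sub_posSemidef (hρ.conjTranspose_mul_mul_same K).1
  have hc' := hc.conjTranspose_mul_mul_same S
  have heq : Sᴴ * (c • 1 - Kᴴ * ρ * K) * S = c • σ - ρ := by
    rw [hSH, hKH, mul_sub, sub_mul, mul_smul_comm, mul_one, smul_mul_assoc, hSS]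
    congr 1
    calc S * (K * ρ * K) * S = S * K * ρ * (K * S) := by simp only [mul_assoc]
      _ = ρ := by rw [hSKρ, hρKS]
  rw [heq] at hc'
  refine ⟨max 1 c, le_max_left _ _, ?_⟩
  have := hc'.add (hσ.smul (sub_nonneg.mpr (le_max_right 1 c)))
  convert this using 1
  rw [sub_smul]
  abel

namespace POVM

variable {X : Type*} [Fintype X] (Λ : POVM n X) {ρ σ : Matrix n n ℂ} {C : ℝ}

lemma trMul_op_le (hC : (C • σ - ρ).PosSemidef) (x : X) :
    trMul (Λ.op x) ρ ≤ C * trMul (Λ.op x) σ := by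
  have := trMul_nonneg hC (Λ.posSemidef x)
  rw [trMul_sub, trMul_smul, trMul_comm σ, trMul_comm ρ] at this
  linarith

lemma trMul_op_eq_zero (hρ : ρ.PosSemidef) (hC : (C • σ - ρ).PosSemidef) (x : X)
    (hx : trMul (Λ.op x) σ = 0) : trMul (Λ.op x) ρ = 0 := by
  have := Λ.trMul_op_le hC x
  rw [hx, mul_zero] at this
  exact le_antisymm this (Λ.trMul_op_nonneg hρ x)

lemma trMul_op_div_le (hσ : σ.PosSemidef) (hC0 : 0 ≤ C)
    (hC : (C • σ - ρ).PosSemidef) (x : X) : trMul (Λ.op x) ρ / trMul (Λ.op x) σ ≤ C :=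
  div_le_of_le_mul₀ (Λ.trMul_op_nonneg hσ x) hC0 (Λ.trMul_op_le hC x)

end POVM

variable {ρ σ : Matrix n n ℂ} {C : ℝ}

lemma measuredRelEnt_le_log (hρ : IsState ρ) (hσ : σ.PosSemidef) (hC1 : 1 ≤ C)
    (hC : (C • σ - ρ).PosSemidef) : measuredRelEnt ρ σ ≤ (Real.log C : ℝ) := by
  refine iSup₂_le fun N Λ => ?_
  rw [relEnt_of_support (Λ.trMul_op_eq_zero hρ.1 hC), EReal.coe_le_coe_iff]
  calc ∑ x, trMul (Λ.op x) ρ * Real.log (trMul (Λ.op x) ρ / trMul (Λ.op x) σ)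
      ≤ ∑ x, trMul (Λ.op x) ρ * Real.log C := by
        refine Finset.sum_le_sum fun x _ =>
          mul_le_mul_of_nonneg_left ?_ (Λ.trMul_op_nonneg hρ.1 x)
        have h0 := div_nonneg (Λ.trMul_op_nonneg hρ.1 x) (Λ.trMul_op_nonneg hσ x)
        rcases h0.eq_or_lt with h0 | h0
        · rw [← h0, Real.log_zero]
          exact Real.log_nonneg hC1
        · exact Real.log_le_log h0 (Λ.trMul_op_div_le hσ (zero_le_one.trans hC1) hC x)
    _ = Real.log C := by rw [← Finset.sum_mul, Λ.sum_trMul_op_state hρ, one_mul]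

lemma exists_measuredRelEnt_eq_coe (hρ : IsState ρ) (hσ : σ.PosSemidef) (hC1 : 1 ≤ C)
    (hC : (C • σ - ρ).PosSemidef) : ∃ D : ℝ, measuredRelEnt ρ σ = D := by
  have htop : measuredRelEnt ρ σ ≠ ⊤ :=
    ((measuredRelEnt_le_log hρ hσ hC1 hC).trans_lt (EReal.coe_lt_top _)).ne
  have hbot : measuredRelEnt ρ σ ≠ ⊥ := fun h =>
    relEnt_ne_bot _ _ (le_bot_iff.mp
      (h ▸ (eigenPOVM (isHermitian_one (n := n) (α := ℂ))).relEnt_le_measuredRelEnt ρ σ))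
  exact ⟨_, (EReal.coe_toReal htop hbot).symm⟩

section Error

variable {δ η : ℝ} {m k : ℕ}

/-- The program loses at most `δ Tr σ + η`: a measurement gives a feasible point with spectrum in
`[δ, C]`, after its likelihood ratios are truncated from below. -/
lemma POVM.sum_sub_le_measuredRelEntApprox {X : Type*} [Fintype X] (Λ : POVM n X)
    (hρ : IsState ρ) (hσ : σ.PosSemidef) (hC1 : 1 ≤ C) (hC : (C • σ - ρ).PosSemidef)
    (hδ : 0 < δ) (hδ1 : δ ≤ 1)
    (herr : ∀ y ∈ Set.Icc δ C, |logApprox m k y - Real.log y| ≤ η) :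
    ((∑ x, trMul (Λ.op x) ρ * Real.log (trMul (Λ.op x) ρ / trMul (Λ.op x) σ) -
      (δ * σ.trace.re + η) : ℝ) : EReal) ≤ measuredRelEntApprox ρ σ m k := by
  set l : X → ℝ := fun x => max (trMul (Λ.op x) ρ / trMul (Λ.op x) σ) δ
  have hl : ∀ x, δ ≤ l x := fun x => le_max_right _ _
  have hlC : ∀ x, l x ≤ C := fun x =>
    max_le (Λ.trMul_op_div_le hσ (zero_le_one.trans hC1) hC x) (hδ1.trans hC1)
  have hval := le_iSup₂ (f := fun (x : Vars n m k) (_ : (approxSDP ρ σ m k).Feasible x) =>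
    (((approxSDP ρ σ m k).objective x : ℝ) : EReal)) _ (Λ.vars_feasible ρ σ m k hδ hl)
  refine le_trans ?_ hval
  rw [Λ.objective_vars, EReal.coe_le_coe_iff]
  have h1 := sum_mul_log_div_le (Λ.trMul_op_nonneg hρ.1) (Λ.trMul_op_nonneg hσ)
    (Λ.sum_trMul_op_state hρ) (Λ.trMul_op_eq_zero hρ.1 hC) hδ
  have h2 : ∑ x, Real.log (l x) * trMul (Λ.op x) ρ - η ≤
      ∑ x, logApprox m k (l x) * trMul (Λ.op x) ρ := by
    rw [← mul_one η, ← Λ.sum_trMul_op_state hρ, Finset.mul_sum, ← Finset.sum_sub_distrib]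
    refine Finset.sum_le_sum fun x _ => ?_
    rw [← sub_mul]
    refine mul_le_mul_of_nonneg_right ?_ (Λ.trMul_op_nonneg hρ.1 x)
    linarith [(abs_le.mp (herr (l x) ⟨hl x, hlC x⟩)).1]
  rw [Λ.sum_trMul_op] at h1
  linarith

/-- The program exceeds the measured relative entropy by at most `δ Tr σ + η`. The spectrum of `ω`
is arbitrary here: below `δ` it is truncated, by monotonicity of the approximation, and above `1` the
approximation is at most the logarithm. -/
lemma objective_sub_le_measuredRelEnt (hρ : IsState ρ) (hσ : σ.PosSemidef)
    (hδ : 0 < δ) (hδ1 : δ ≤ 1)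
    (herr : ∀ y ∈ Set.Icc δ 1, |logApprox m k y - Real.log y| ≤ η) {x : Vars n m k}
    (hx : (approxSDP ρ σ m k).Feasible x) :
    (((approxSDP ρ σ m k).objective x - (δ * σ.trace.re + η) : ℝ) : EReal) ≤
      measuredRelEnt ρ σ := by
  have hω : (x.ω : Matrix n n ℂ).PosDef := ((approxSDP_feasible_iff ρ σ x).mp hx).1
  have hη : 0 ≤ η := (abs_nonneg _).trans (herr 1 ⟨hδ1, le_rfl⟩)
  have happrox : ∀ y, 0 < y → logApprox m k y ≤ Real.log (max y δ) + η := by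
    intro y hy
    refine (logApprox_mono m k hy (le_max_left y δ)).trans ?_
    rcases le_total (max y δ) 1 with h | h
    · linarith [(abs_le.mp (herr _ ⟨le_max_right _ _, h⟩)).2]
    · linarith [logApprox_le_log m k h]
  set μ := (Herm.isHermitian x.ω).eigenvalues
  set Λ := eigenPOVM (Herm.isHermitian x.ω)
  have hμ : ∀ i, 0 < μ i := hω.eigenvalues_pos
  refine le_trans ?_ (variational_le_measuredRelEnt hρ hσ (Herm.isHermitian x.ω)
    (l := fun i => max (μ i) δ) fun i => lt_max_of_lt_right hδ)
  rw [EReal.coe_le_coe_iff, approxSDP_objective]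
  have h1 := trMul_theta_le hρ.1 hx
  have h2 : ∑ i, logApprox m k (μ i) * trMul (Λ.op i) ρ ≤
      ∑ i, Real.log (max (μ i) δ) * trMul (Λ.op i) ρ + η := by
    rw [← mul_one η, ← Λ.sum_trMul_op_state hρ, Finset.mul_sum, ← Finset.sum_add_distrib]
    refine Finset.sum_le_sum fun i _ => ?_
    rw [← add_mul]
    exact mul_le_mul_of_nonneg_right (happrox _ (hμ i)) (Λ.trMul_op_nonneg hρ.1 i)
  have h3 : ∑ i, max (μ i) δ * trMul (Λ.op i) σ ≤ trMul x.ω σ + δ * σ.trace.re := by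
    rw [trMul_eq_sum_eigenvalues (Herm.isHermitian x.ω) σ, ← Λ.sum_trMul_op, Finset.mul_sum,
      ← Finset.sum_add_distrib]
    refine Finset.sum_le_sum fun i _ => ?_
    rw [← show Λ.op i = eigenProj (Herm.isHermitian x.ω) i from rfl, ← add_mul]
    refine mul_le_mul_of_nonneg_right ?_ (Λ.trMul_op_nonneg hσ i)
    exact max_le (by linarith) (by linarith [hμ i])
  change trMul x.θ ρ ≤ ∑ i, logApprox m k (μ i) * trMul (Λ.op i) ρ at h1
  change trMul x.θ ρ - trMul x.ω σ + 1 - (δ * σ.trace.re + η) ≤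
    ∑ i, Real.log (max (μ i) δ) * trMul (Λ.op i) ρ - ∑ i, max (μ i) δ * trMul (Λ.op i) σ + 1
  linarith

lemma exists_abs_sub_le (hρ : IsState ρ) (hσ : σ.PosSemidef) (hC1 : 1 ≤ C)
    (hC : (C • σ - ρ).PosSemidef) (hδ : 0 < δ) (hδ1 : δ ≤ 1)
    (herr : ∀ y ∈ Set.Icc δ C, |logApprox m k y - Real.log y| ≤ η) :
    ∃ D D' : ℝ, measuredRelEnt ρ σ = D ∧ measuredRelEntApprox ρ σ m k = D' ∧
      |D - D'| ≤ δ * σ.trace.re + η := by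
  set e := δ * σ.trace.re + η
  obtain ⟨D, hD⟩ := exists_measuredRelEnt_eq_coe hρ hσ hC1 hC
  have hupper : measuredRelEntApprox ρ σ m k ≤ ((D + e : ℝ) : EReal) := by
    refine iSup₂_le fun x hx => ?_
    have h := objective_sub_le_measuredRelEnt hρ hσ hδ hδ1
      (fun y hy => herr y ⟨hy.1, hy.2.trans hC1⟩) hx
    rw [hD, EReal.coe_le_coe_iff] at h
    exact EReal.coe_le_coe_iff.mpr (by linarith)
  have htop : measuredRelEntApprox ρ σ m k ≠ ⊤ := (hupper.trans_lt (EReal.coe_lt_top _)).ne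
  have hbot : measuredRelEntApprox ρ σ m k ≠ ⊥ := fun h =>
    EReal.coe_ne_bot _ (le_bot_iff.mp (h ▸
      (eigenPOVM (isHermitian_one (n := n) (α := ℂ))).sum_sub_le_measuredRelEntApprox
        hρ hσ hC1 hC hδ hδ1 herr))
  obtain ⟨D', hD'⟩ : ∃ D' : ℝ, measuredRelEntApprox ρ σ m k = D' :=
    ⟨_, (EReal.coe_toReal htop hbot).symm⟩
  have hlower : measuredRelEnt ρ σ ≤ ((D' + e : ℝ) : EReal) := by
    refine iSup₂_le fun N Λ => ?_
    have h := Λ.sum_sub_le_measuredRelEntApprox hρ hσ hC1 hC hδ hδ1 herr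
    rw [hD', EReal.coe_le_coe_iff] at h
    rw [relEnt_of_support (Λ.trMul_op_eq_zero hρ.1 hC), EReal.coe_le_coe_iff]
    linarith
  rw [hD', EReal.coe_le_coe_iff] at hupper
  rw [hD, EReal.coe_le_coe_iff] at hlower
  exact ⟨D, D', hD, hD', abs_le.mpr ⟨by linarith, by linarith⟩⟩

end Error

/-! ### Choice of the parameters -/

/-- With `4M` square roots and `4M` nodes, where `M²` dominates the range `L` of the logarithm, the
error decays like `exp (-M²)`. -/
lemma abs_logApprox_sub_log_le_exp {M : ℕ} (hM : 1 ≤ M) {y L : ℝ} (hy : 0 < y)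
    (hL : |Real.log y| ≤ L) (hLM : 2 * L ≤ (M : ℝ) ^ 2) :
    |logApprox (4 * M) (4 * M) y - Real.log y| ≤ Real.exp (-(M : ℝ) ^ 2) := by
  have hL0 : 0 ≤ L := (abs_nonneg _).trans hL
  set b : ℝ := 2 ^ (2 * M) with hb
  have hb0 : 0 < b := by positivity
  have hb1 : 1 ≤ b := one_le_pow₀ one_le_two
  have hMb : (M : ℝ) ^ 2 ≤ b := by
    have : (M : ℝ) ≤ 2 ^ M := by exact_mod_cast Nat.lt_two_pow_self.le
    calc (M : ℝ) ^ 2 ≤ (2 ^ M) ^ 2 := by gcongr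
      _ = b := by rw [hb, ← pow_mul, mul_comm]
  have hbb : (2 : ℝ) ^ (4 * M) = b * b := by
    rw [hb, ← pow_add]
    congr 1
    omega
  have hLb : L ≤ b := by linarith
  have hratio : 2 * L / 2 ^ (4 * M) ≤ b⁻¹ := by
    rw [hbb, div_le_iff₀ (by positivity), ← mul_assoc, inv_mul_cancel₀ hb0.ne', one_mul]
    exact hLM.trans hMb
  have hbinv : b⁻¹ ≤ 1 := inv_le_one_of_one_le₀ hb1
  have hquarter : b⁻¹ = (1 / 4) ^ M := by
    rw [hb, pow_mul, ← inv_pow]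
    norm_num
  have hexp : (1 / 4 : ℝ) ≤ Real.exp (-1) := by
    rw [Real.exp_neg, one_div]
    exact inv_anti₀ (Real.exp_pos 1) (by linarith [Real.exp_one_lt_d9])
  calc |logApprox (4 * M) (4 * M) y - Real.log y|
      ≤ L * (2 * L / 2 ^ (4 * M)) ^ (2 * (4 * M)) :=
        abs_logApprox_sub_log_le _ _ hy hL (hLb.trans (by rw [hbb]; nlinarith))
    _ ≤ b * b⁻¹ ^ (M + 1) := by
        refine mul_le_mul hLb ?_ (by positivity) hb0.le
        exact (pow_le_pow_left₀ (by positivity) hratio _).trans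
          (pow_le_pow_of_le_one (by positivity) hbinv (by omega))
    _ = ((1 / 4) ^ M) ^ M := by
        rw [pow_succ, hquarter]
        have : b * (1 / 4) ^ M = 1 := by rw [← hquarter, mul_inv_cancel₀ hb0.ne']
        calc b * (((1 / 4) ^ M) ^ M * (1 / 4) ^ M)
            = ((1 / 4) ^ M) ^ M * (b * (1 / 4) ^ M) := by ring
          _ = _ := by rw [this, mul_one]
    _ ≤ (Real.exp (-1) ^ M) ^ M := by gcongr
    _ = Real.exp (-(M : ℝ) ^ 2) := by
        rw [← pow_mul, ← Real.exp_nat_mul]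
        congr 1
        push_cast
        ring

/-- The number of square roots and of nodes for the accuracy `ε`, up to a constant factor `A`. -/
def stepCount (A ε : ℝ) : ℕ := 4 * ⌈A * √(Real.log (1 / min ε (Real.exp (-1))))⌉₊

lemma stepCount_isBigO {A : ℝ} (hA : 0 ≤ A) :
    (fun ε => ((stepCount A ε + stepCount A ε : ℕ) : ℝ)) =O[𝓝[>] 0]
      (fun ε => √(Real.log (1 / ε))) := by
  refine IsBigO.of_bound (8 * (A + 1)) ?_
  filter_upwards [Ioo_mem_nhdsGT (Real.exp_pos (-1))] with ε hε
  rw [stepCount, min_eq_left hε.2.le]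
  have ha : 1 ≤ √(Real.log (1 / ε)) := by
    rw [Real.one_le_sqrt, one_div, Real.log_inv, le_neg]
    exact (Real.log_le_iff_le_exp hε.1).mpr hε.2.le
  have hc := (Nat.ceil_lt_add_one (show 0 ≤ A * √(Real.log (1 / ε)) by positivity)).le
  rw [Real.norm_of_nonneg (Nat.cast_nonneg _), Real.norm_of_nonneg (Real.sqrt_nonneg _)]
  push_cast
  linarith

/-- For `A` large, `stepCount A ε` steps give the accuracy `ε / 2` on `[δ, C]`, where `δ` is
proportional to `ε`: the range of the logarithm is then `O(ln (1 / ε))`, and the error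
`exp (-M²)` is below `ε²`. -/
lemma exists_stepCount_error (s : ℝ) (hs : 0 ≤ s) {C : ℝ} (hC : 1 ≤ C) :
    ∃ A : ℝ, 0 ≤ A ∧ ∀ ε : ℝ, 0 < ε → 1 ≤ stepCount A ε ∧ ∃ δ η : ℝ, 0 < δ ∧ δ ≤ 1 ∧
      δ * s + η ≤ ε ∧
      ∀ y ∈ Set.Icc δ C, |logApprox (stepCount A ε) (stepCount A ε) y - Real.log y| ≤ η := by
  set c := Real.log (2 * (1 + s)) + Real.log C with hc
  have hc0 : 0 ≤ c := add_nonneg (Real.log_nonneg (by linarith)) (Real.log_nonneg hC)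
  refine ⟨2 * (1 + c), by positivity, fun ε hε => ?_⟩
  set ε' := min ε (Real.exp (-1)) with hε'
  have hε'0 : 0 < ε' := lt_min hε (Real.exp_pos _)
  set T := Real.log (1 / ε') with hT
  have hT1 : 1 ≤ T := by
    rw [hT, one_div, Real.log_inv, le_neg]
    exact (Real.log_le_iff_le_exp hε'0).mpr (min_le_right _ _)
  have hεT : ε' = Real.exp (-T) := by
    rw [hT, one_div, Real.log_inv, neg_neg, Real.exp_log hε'0]
  set M := ⌈2 * (1 + c) * √T⌉₊ with hM
  have hstep : stepCount (2 * (1 + c)) ε = 4 * M := rfl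
  have hceil : 2 * (1 + c) * √T ≤ M := Nat.le_ceil _
  have hsqrt1 : 1 ≤ √T := Real.one_le_sqrt.mpr hT1
  have hM1 : 1 ≤ M := Nat.one_le_ceil_iff.mpr (by positivity)
  have hM2 : 4 * (1 + c) * T ≤ (M : ℝ) ^ 2 := by
    calc 4 * (1 + c) * T ≤ 4 * (1 + c) ^ 2 * T := by
          refine mul_le_mul_of_nonneg_right ?_ (by linarith)
          nlinarith
      _ = (2 * (1 + c) * √T) ^ 2 := by
          rw [mul_pow, Real.sq_sqrt (by linarith)]
          ring
      _ ≤ _ := by gcongr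
  refine ⟨by omega, ε' / (2 * (1 + s)), ε' / 2, by positivity, ?_, ?_, fun y hy => ?_⟩
  · have : ε' ≤ 1 := (min_le_right _ _).trans (Real.exp_le_one_iff.mpr (by norm_num))
    rw [div_le_one (by positivity)]
    linarith
  · have h1 : ε' / (2 * (1 + s)) * s ≤ ε' / 2 := by
      rw [div_mul_eq_mul_div, div_le_div_iff₀ (by positivity) two_pos]
      nlinarith
    linarith [min_le_left ε (Real.exp (-1))]
  · have hδ : 0 < ε' / (2 * (1 + s)) := by positivity
    have hy0 : 0 < y := hδ.trans_le hy.1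
    have hlog : |Real.log y| ≤ T + c := by
      rw [abs_le]
      constructor
      · have h1 := Real.log_le_log hδ hy.1
        rw [Real.log_div hε'0.ne' (by positivity)] at h1
        have h2 : Real.log ε' = -T := by rw [hεT, Real.log_exp]
        linarith [Real.log_nonneg hC]
      · have h1 := Real.log_le_log hy0 hy.2
        linarith [Real.log_nonneg (show 1 ≤ 2 * (1 + s) by linarith)]
    rw [hstep]
    refine (abs_logApprox_sub_log_le_exp hM1 hy0 hlog (by nlinarith)).trans ?_
    calc Real.exp (-(M : ℝ) ^ 2) ≤ Real.exp (-T + -1) := Real.exp_le_exp.mpr (by nlinarith)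
      _ = ε' * Real.exp (-1) := by rw [Real.exp_add, hεT]
      _ ≤ ε' / 2 := by
          rw [div_eq_mul_inv]
          refine mul_le_mul_of_nonneg_left ?_ hε'0.le
          rw [Real.exp_neg]
          exact inv_anti₀ two_pos (by linarith [Real.add_one_le_exp (1 : ℝ)])

end

end MeasuredRelEnt

end

open MeasuredRelEnt in
theorem proposition6 {n : Type*} [Fintype n] [DecidableEq n] (ρ σ : Matrix n n ℂ)
    (hρ : IsState ρ) (hσ : σ.PosSemidef) :
    measuredRelEnt ρ σ =
      sSup {v : EReal | ∃ ω θ : Matrix n n ℂ, ω.PosDef ∧ θ.IsHermitian ∧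
        (connection Real.log 1 ω - θ).PosSemidef ∧
        v = ((trMul θ ρ - trMul ω σ + 1 : ℝ) : EReal)} ∧
    (support ρ ≤ support σ →
      ∃ m k : ℝ → ℕ,
        (fun ε => ((m ε + k ε : ℕ) : ℝ)) =O[𝓝[>] 0] (fun ε => √(Real.log (1 / ε))) ∧
        ∀ ε : ℝ, 0 < ε → 1 ≤ m ε ∧ 1 ≤ k ε ∧
          ∃ D D' : ℝ, measuredRelEnt ρ σ = D ∧
            measuredRelEntApprox ρ σ (m ε) (k ε) = D' ∧ |D - D'| ≤ ε) := by
  refine ⟨measuredRelEnt_eq_sSup hρ hσ, fun hsupp => ?_⟩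
  obtain ⟨C, hC1, hC⟩ := exists_smul_sub_posSemidef_of_support_le hρ.1 hσ hsupp
  obtain ⟨A, hA, h⟩ := exists_stepCount_error σ.trace.re
    (Complex.nonneg_iff.mp hσ.trace_nonneg).1 hC1
  refine ⟨stepCount A, stepCount A, stepCount_isBigO hA, fun ε hε => ?_⟩
  obtain ⟨h1, δ, η, hδ, hδ1, hsum, herr⟩ := h ε hε
  obtain ⟨D, D', hD, hD', hle⟩ := exists_abs_sub_le hρ hσ hC1 hC hδ hδ1 herr
  exact ⟨h1, h1, D, D', hD, hD', hle.trans hsum⟩
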